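/- Let $\lambda>0$ and let $\Phi$ be a homogeneous Poisson point process of intensity $\lambda$ on $\mathbb{R}^2$. For $X\in\Phi$ let $\mathcal{V}_X=\{x\in\mathbb{R}^2:\|x-X\|\le\|x-Y\|\text{ for all }Y\in\Phi\}$ be its Voronoi cell. Two distinct points $D,D'\in\Phi$ are called Delaunay neighbors if $\mathcal{V}_D\cap\mathcal{V}_{D'}$ is a one-dimensional facet, that is, contains more than one point. Order $\mathbb{R}^2$ by the first coordinate (ties being broken by the second coordinate), and fix a direction of rotation of the plane (clockwise or counterclockwise). For $\theta\in(0,2\pi)$ let $\Psi_\theta$ be the set of all points $Z\in\mathbb{R}^2$ for which there are Delaunay neighbors $D<D'$ such that $Z\in\mathcal{V}_D\cap\mathcal{V}_{D'}$ and the oriented angle at $Z$ from $D$ to $D'$, measured in the fixed direction, is equal to $\theta$ modulo $2\pi$. Then, for every $\theta\in(0,2\pi)$, $\Psi_\theta$ is a point process on $\mathbb{R}^2$ which is stationary and ergodic with respect to the translations of $\mathbb{R}^2$, and its intensity is $2\lambda\sin^2(\theta/2)$; that is, $\mathbb{E}[\#(\Psi_\theta\cap B)]=2\lambda\sin^2(\theta/2)\,|B|$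 for every Borel set $B\subseteq\mathbb{R}^2$, where $|B|$ is the area of $B$. -/

import Mathlib

open MeasureTheory ProbabilityTheory
open scoped NNReal ENNReal

namespace PoissonVoronoi

/-- The Euclidean plane. -/
abbrev Plane : Type := EuclideanSpace ℝ (Fin 2)

instance : Fact (Module.finrank ℝ Plane = 2) := ⟨finrank_euclideanSpace_fin⟩

/-! ### Point processes

A (simple) point process is given as a random set of points of the plane. A set of points is
identified with its counting measure, so that the space of configurations carries the
`σ`-algebra generated by the numbers of points in Borel sets. -/

/-- The counting measure `∑_{x ∈ S} δ_x` of a set of points `S`. -/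
noncomputable def pointMeasure (S : Set Plane) : Measure Plane :=
  Measure.count.restrict S

/-- The random set `Ξ` is a simple point process: it is almost surely locally finite, and its
counting measure is a random measure. -/
structure IsPointProcess {Ω : Type*} [MeasurableSpace Ω] (P : Measure Ω)
    (Ξ : Ω → Set Plane) : Prop where
  locallyFinite : ∀ᵐ ω ∂P, ∀ B : Set Plane, Bornology.IsBounded B → (Ξ ω ∩ B).Finite
  aemeasurable : AEMeasurable (fun ω => pointMeasure (Ξ ω)) P

/-- `Φ` is a homogeneous Poisson point process of intensity `lam`. -/
structure IsPoissonProcess {Ω : Type*} [MeasurableSpace Ω] (P : Measure Ω)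
    (Φ : Ω → Set Plane) (lam : ℝ≥0) : Prop where
  isPointProcess : IsPointProcess P Φ
  hasLaw_count : ∀ B : Set Plane, MeasurableSet B → volume B ≠ ∞ →
    HasLaw (fun ω => pointMeasure (Φ ω) B)
      ((poissonMeasure (lam * (volume B).toNNReal)).map (fun k : ℕ => (k : ℝ≥0∞))) P
  iIndepFun_count : ∀ (n : ℕ) (B : Fin n → Set Plane), (∀ i, MeasurableSet (B i)) →
    Pairwise (fun i j => Disjoint (B i) (B j)) →
    iIndepFun (fun i ω => pointMeasure (Φ ω) (B i)) P

/-- The distribution of a point process. -/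
noncomputable def law {Ω : Type*} [MeasurableSpace Ω] (P : Measure Ω)
    (Ξ : Ω → Set Plane) : Measure (Measure Plane) :=
  P.map (fun ω => pointMeasure (Ξ ω))

/-- Translation of a configuration (as a measure) by the vector `v`. -/
noncomputable def translateMeasure (v : Plane) (μ : Measure Plane) : Measure Plane :=
  μ.map (fun x => x + v)

/-- The distribution of the point process is invariant under all translations. -/
def IsStationary {Ω : Type*} [MeasurableSpace Ω] (P : Measure Ω) (Ξ : Ω → Set Plane) : Prop :=
  ∀ v : Plane, MeasurePreserving (translateMeasure v) (law P Ξ) (law P Ξ)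

/-- Every event that is (almost surely) invariant under all translations has probability
`0` or `1`. -/
def IsErgodic {Ω : Type*} [MeasurableSpace Ω] (P : Measure Ω) (Ξ : Ω → Set Plane) : Prop :=
  ∀ A : Set (Measure Plane), MeasurableSet A →
    (∀ v : Plane, translateMeasure v ⁻¹' A =ᵐ[law P Ξ] A) → law P Ξ A = 0 ∨ law P Ξ A = 1

/-- The mean number of points in every Borel set `B` is `γ` times the area of `B`. -/
def HasIntensity {Ω : Type*} [MeasurableSpace Ω] (P : Measure Ω) (Ξ : Ω → Set Plane)
    (γ : ℝ≥0∞) : Prop :=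
  ∀ B : Set Plane, MeasurableSet B → ∫⁻ ω, pointMeasure (Ξ ω) B ∂P = γ * volume B

/-! ### Voronoi tessellation and angles -/

/-- The Voronoi cell of the nucleus `X` of the configuration `S`. -/
def voronoiCell (S : Set Plane) (X : Plane) : Set Plane :=
  {z | ∀ Y ∈ S, dist z X ≤ dist z Y}

/-- `D` and `D'` are Delaunay neighbours in `S`: two distinct points of `S` whose Voronoi cells
share a one-dimensional facet. The intersection of the two cells is a convex subset of the
bisector line, hence it is one-dimensional if and only if it has at least two points. -/
def IsDelaunayPair (S : Set Plane) (D D' : Plane) : Prop :=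
  D ∈ S ∧ D' ∈ S ∧ D ≠ D' ∧ (voronoiCell S D ∩ voronoiCell S D').Nontrivial

/-- The order of the plane by first coordinate (ties are broken by the second one). -/
def Precedes (D D' : Plane) : Prop :=
  D 0 < D' 0 ∨ (D 0 = D' 0 ∧ D 1 < D' 1)

/-- The points of the one-dimensional Voronoi facets of `S` that see the Delaunay
neighbours `D`, `D'` of the facet, ordered so that `D` precedes `D'`, with angle `θ` mod `2π`, the
angle being measured from `D` to `D'` in the direction of rotation given by `o`. -/
def anglePoints (o : Orientation ℝ Plane (Fin 2)) (θ : ℝ) (S : Set Plane) : Set Plane :=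
  {z | ∃ D D' : Plane, IsDelaunayPair S D D' ∧ Precedes D D' ∧
    z ∈ voronoiCell S D ∩ voronoiCell S D' ∧
    o.oangle (D - z) (D' - z) = (θ : Real.Angle)}

end PoissonVoronoi

/-! For points `x` preceding `y`, exactly one point `z` is equidistant from both and sees them at
oriented angle θ: the point `angleVertex`, at distance ‖y - x‖ / (2 sin (θ/2)) from each. If `x` and
`y` belong to Φ, it lies in both Voronoi cells exactly when the open disc about `z` through `x` and
`y` contains no point of Φ. Almost surely no third point lies on such a circle
(`ae_noThirdCocircular`); then every pair with an empty disc is a Delaunay pair, and distinct pairs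
have distinct vertices. So counting Ψ_θ means counting ordered pairs with an empty disc
(`angleMeasure_pointMeasure`).

Intensity: by the Mecke equation for pairs, the mean number of points in `B` is λ² times the
integral, over `x` preceding `y` with vertex in `B`, of the void probability exp(-λπ‖y - x‖² / (4
sin²(θ/2))). Put u = y - x. Integrating over `x` gives |B|, and u runs through a half-plane, which
gives half of the Gaussian integral 4 sin²(θ/2) / λ. The product is 2λ sin²(θ/2) |B|. Finite means
on balls yield local finiteness.

Stationarity and ergodicity: the counting measure of Ψ_θ is almost surely the value of a measurable,
translation-equivariant functional (`angleMeasure`) of that of Φ, so both properties are inherited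
from the Poisson process. That process is stationary because its counts determine its law
(`IsPoissonLaw.ext`). It is ergodic because an invariant event A is nearly a bounded-window event T,
and T is independent of a far translate of itself, whence P(A) = P(A)². -/

namespace PoissonVoronoi

/-! ### Poisson laws on `[0, ∞]` and their products -/

/-- The Poisson distribution, as a measure on `[0, ∞]`. -/
noncomputable def poissonENNReal (c : ℝ≥0) : Measure ℝ≥0∞ :=
  (poissonMeasure c).map (fun k : ℕ => (k : ℝ≥0∞))

instance (c : ℝ≥0) : IsProbabilityMeasure (poissonENNReal c) :=
  Measure.isProbabilityMeasure_map (by fun_prop)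

lemma lintegral_poissonENNReal (c : ℝ≥0) {g : ℝ≥0∞ → ℝ≥0∞} (hg : Measurable g) :
    ∫⁻ k, g k ∂(poissonENNReal c)
      = ∑' n : ℕ, ENNReal.ofReal (Real.exp (-c) * c ^ n / n.factorial) * g n := by
  rw [poissonENNReal, lintegral_map hg (by fun_prop), poissonMeasure, lintegral_sum_measure]
  simp [lintegral_smul_measure]

/-- With weights p_n = e^(-c) c^n / n!, one has (n + 1) p_(n+1) = c p_n, while the term n = 0
vanishes. This is the one-dimensional seed of the Mecke equation. -/
lemma lintegral_mul_poissonENNReal (c : ℝ≥0) {g : ℝ≥0∞ → ℝ≥0∞} (hg : Measurable g) :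
    ∫⁻ k, k * g k ∂(poissonENNReal c) = c * ∫⁻ k, g (k + 1) ∂(poissonENNReal c) := by
  rw [lintegral_poissonENNReal c (by fun_prop), lintegral_poissonENNReal c (by fun_prop),
    tsum_eq_zero_add' ENNReal.summable, ← ENNReal.tsum_mul_left]
  simp only [Nat.cast_zero, zero_mul, mul_zero, zero_add]
  refine tsum_congr fun n => ?_
  have h : ENNReal.ofReal (Real.exp (-c) * c ^ (n + 1) / (n + 1).factorial) * ((n + 1 : ℕ) : ℝ≥0∞)
      = c * ENNReal.ofReal (Real.exp (-c) * c ^ n / n.factorial) := by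
    rw [← ENNReal.ofReal_natCast, ← ENNReal.ofReal_mul (by positivity), ← ENNReal.ofReal_coe_nnreal,
      ← ENNReal.ofReal_mul (by positivity)]
    congr 1
    rw [Nat.factorial_succ]
    push_cast
    field_simp
    ring
  rw [← mul_assoc, h, mul_assoc]
  push_cast
  rfl

lemma ae_lt_top_poissonENNReal (c : ℝ≥0) : ∀ᵐ k ∂(poissonENNReal c), k < ∞ := by
  rw [poissonENNReal, ae_map_iff (by fun_prop) measurableSet_Iio]
  simp

lemma poissonENNReal_singleton_zero (c : ℝ≥0) :
    poissonENNReal c {0} = ENNReal.ofReal (Real.exp (-c)) := by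
  rw [poissonENNReal, Measure.map_apply (by fun_prop) (measurableSet_singleton 0)]
  have : (fun k : ℕ => (k : ℝ≥0∞)) ⁻¹' {0} = {0} := by ext; simp
  rw [this, poissonMeasure_singleton]
  simp

/-- Multiplying a product of Poisson laws by a coordinate amounts to shifting that coordinate. -/
lemma lintegral_mul_pi_poissonENNReal {ι : Type*} [Fintype ι] [DecidableEq ι] (c : ι → ℝ≥0) (j : ι)
    {g : (ι → ℝ≥0∞) → ℝ≥0∞} (hg : Measurable g) :
    ∫⁻ k, k j * g k ∂(Measure.pi fun i => poissonENNReal (c i))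
      = c j * ∫⁻ k, g (k + Pi.single j 1) ∂(Measure.pi fun i => poissonENNReal (c i)) := by
  rw [← lintegral_const_mul _ (by fun_prop)]
  -- It suffices to integrate out coordinate `j` alone, with the others frozen.
  refine lintegral_eq_of_lmarginal_eq {j} (by fun_prop) (by fun_prop) ?_
  rw [lmarginal_singleton, lmarginal_singleton]
  funext x
  simp only [Function.update_self]
  rw [lintegral_const_mul _ (by fun_prop),
    lintegral_mul_poissonENNReal (g := fun k => g (Function.update x j k)) _ (by fun_prop)]
  congr! 5 with k
  funext i
  by_cases h : i = j
  · subst h; simp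
  · simp [h]

/-- The joint distribution of the numbers of points in disjoint sets of finite area is that of a
Poisson process of intensity `lam`. -/
def IsPoissonLaw (Q : Measure (Measure Plane)) (lam : ℝ≥0) : Prop :=
  ∀ (n : ℕ) (C : Fin n → Set Plane), (∀ i, MeasurableSet (C i)) → (∀ i, volume (C i) ≠ ∞) →
    Pairwise (fun i j => Disjoint (C i) (C j)) →
    Q.map (fun μ i => μ (C i))
      = Measure.pi (fun i => poissonENNReal (lam * (volume (C i)).toNNReal))

namespace IsPoissonProcess

lemma aemeasurable_pointMeasure {Ω : Type*} [MeasurableSpace Ω] {P : Measure Ω}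
    {Φ : Ω → Set Plane} {lam : ℝ≥0} (h : IsPoissonProcess P Φ lam) :
    AEMeasurable (fun ω => pointMeasure (Φ ω)) P := by
  obtain ⟨⟨-, hm⟩, -, -⟩ := h
  exact hm

lemma ae_locallyFinite {Ω : Type*} [MeasurableSpace Ω] {P : Measure Ω}
    {Φ : Ω → Set Plane} {lam : ℝ≥0} (h : IsPoissonProcess P Φ lam) :
    ∀ᵐ ω ∂P, ∀ B : Set Plane, Bornology.IsBounded B → (Φ ω ∩ B).Finite := by
  obtain ⟨⟨hfin, -⟩, -, -⟩ := h
  exact hfin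

lemma isPoissonLaw {Ω : Type*} [MeasurableSpace Ω] {P : Measure Ω}
    [IsProbabilityMeasure P] {Φ : Ω → Set Plane} {lam : ℝ≥0} (h : IsPoissonProcess P Φ lam) :
    IsPoissonLaw (law P Φ) lam := by
  intro n C hC hfin hdisj
  have hm : Measurable (fun (μ : Measure Plane) (i : Fin n) => μ (C i)) :=
    measurable_pi_lambda _ fun i => Measure.measurable_coe (hC i)
  rw [law, AEMeasurable.map_map_of_aemeasurable hm.aemeasurable h.aemeasurable_pointMeasure]
  have h1 := (iIndepFun_iff_map_fun_eq_pi_map (fun i =>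
    (h.hasLaw_count (C i) (hC i) (hfin i)).aemeasurable)).1 (h.iIndepFun_count n C hC hdisj)
  refine h1.trans ?_
  congr 1
  funext i
  exact (h.hasLaw_count (C i) (hC i) (hfin i)).map_eq

end IsPoissonProcess

/-! ### Cylinder events and window σ-algebras -/

/-- The measurable subsets of `W` of finite area. -/
def finiteAreaSets (W : Set Plane) : Set (Set Plane) :=
  {B | MeasurableSet B ∧ volume B ≠ ∞ ∧ B ⊆ W}

/-- The `σ`-algebra generated by the number of points in `B`. -/
abbrev countAlgebra (B : Set Plane) : MeasurableSpace (Measure Plane) :=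
  MeasurableSpace.comap (fun μ => μ B) inferInstance

/-- The events that are determined by finitely many counts in the window `W`. -/
def cylinders (W : Set Plane) : Set (Set (Measure Plane)) :=
  piiUnionInter (fun B => {s | MeasurableSet[countAlgebra B] s}) (finiteAreaSets W)

/-- The `σ`-algebra generated by the points in the window `W`. -/
@[reducible] def windowAlgebra (W : Set Plane) : MeasurableSpace (Measure Plane) :=
  ⨆ B ∈ finiteAreaSets W, countAlgebra B

lemma isPiSystem_cylinders (W : Set Plane) : IsPiSystem (cylinders W) :=
  isPiSystem_piiUnionInter _
    (fun B => @MeasurableSpace.isPiSystem_measurableSet _ (countAlgebra B)) _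

lemma generateFrom_cylinders (W : Set Plane) :
    MeasurableSpace.generateFrom (cylinders W) = windowAlgebra W :=
  generateFrom_piiUnionInter_measurableSet _ _

lemma windowAlgebra_mono {W W' : Set Plane} (h : W ⊆ W') : windowAlgebra W ≤ windowAlgebra W' :=
  iSup₂_le fun B hB => le_iSup₂_of_le B ⟨hB.1, hB.2.1, hB.2.2.trans h⟩ le_rfl

lemma windowAlgebra_le (W : Set Plane) :
    windowAlgebra W ≤ (inferInstance : MeasurableSpace (Measure Plane)) :=
  iSup₂_le fun _ hB => (Measure.measurable_coe hB.1).comap_le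

lemma univ_mem_cylinders (W : Set Plane) : Set.univ ∈ cylinders W :=
  ⟨∅, by simp, fun _ => Set.univ, by simp, by simp⟩

/-- The count in any measurable set is the supremum of its counts within growing balls, so bounded
windows generate everything. -/
lemma iSup_windowAlgebra_ball :
    ⨆ n : ℕ, windowAlgebra (Metric.ball 0 n)
      = (inferInstance : MeasurableSpace (Measure Plane)) := by
  refine le_antisymm (iSup_le fun n => windowAlgebra_le _) ?_
  refine iSup₂_le fun s hs => ?_
  have h : (fun μ : Measure Plane => μ s) = fun μ => ⨆ n : ℕ, μ (s ∩ Metric.ball 0 n) := by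
    funext μ
    have hmono : Monotone fun n : ℕ => s ∩ Metric.ball (0 : Plane) n := fun m n hmn =>
      Set.inter_subset_inter_right _ (Metric.ball_subset_ball (by exact_mod_cast hmn))
    rw [← hmono.measure_iUnion, ← Set.inter_iUnion, Metric.iUnion_ball_nat, Set.inter_univ]
  refine Measurable.comap_le (m₁ := ⨆ n : ℕ, windowAlgebra (Metric.ball 0 n)) ?_
  rw [h]
  refine Measurable.iSup fun n => ?_
  refine Measurable.mono (comap_measurable _) ?_ le_rfl
  refine le_trans ?_ (le_iSup _ n)
  exact le_iSup₂_of_le (s ∩ Metric.ball 0 n) ⟨hs.inter measurableSet_ball,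
    ((measure_mono Set.inter_subset_right).trans_lt measure_ball_lt_top).ne,
    Set.inter_subset_right⟩ le_rfl

lemma generateFrom_cylinders_univ : MeasurableSpace.generateFrom (cylinders Set.univ)
    = (inferInstance : MeasurableSpace (Measure Plane)) := by
  rw [generateFrom_cylinders]
  refine le_antisymm (windowAlgebra_le _) ?_
  rw [← iSup_windowAlgebra_ball]
  exact iSup_le fun n => windowAlgebra_mono (Set.subset_univ _)

/-- Finitely many sets are unions of members of a common finite disjoint family. -/
lemma exists_disjoint_refinement {W : Set Plane} (t : Finset (Set Plane))
    (ht : ∀ B ∈ t, B ∈ finiteAreaSets W) :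
    ∃ (n : ℕ) (C : Fin n → Set Plane), (∀ i, C i ∈ finiteAreaSets W) ∧
      Pairwise (fun i j => Disjoint (C i) (C j)) ∧
      ∀ B ∈ t, ∃ J : Finset (Fin n), B = ⋃ j ∈ J, C j := by
  classical
  -- The disjoint family consists of the fibres of `φ`, that is, the atoms cut out by `t`. The fibre
  -- over the empty subset is omitted: it is the complement of the union of `t` and has infinite
  -- area.
  let φ : Plane → Finset (Set Plane) := fun x => t.filter (x ∈ ·)
  let ι := {s // s ∈ t.powerset.erase ∅}
  let e : Fin (Fintype.card ι) ≃ ι := (Fintype.equivFin ι).symm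
  have hsub (i) : (e i).1 ⊆ t := Finset.mem_powerset.1 (Finset.mem_of_mem_erase (e i).2)
  refine ⟨Fintype.card ι, fun i => {x | φ x = (e i).1}, fun i => ?_, fun i j hij => ?_,
    fun B hB => ?_⟩
  · obtain ⟨B, hB⟩ := Finset.nonempty_iff_ne_empty.2 (Finset.ne_of_mem_erase (e i).2)
    have hsubB : {x | φ x = (e i).1} ⊆ B := fun x hx => by
      have : B ∈ φ x := by rw [hx]; exact hB
      exact (Finset.mem_filter.1 this).2
    have hBt := ht B (hsub i hB)
    refine ⟨?_, ((measure_mono hsubB).trans_lt hBt.2.1.lt_top).ne, hsubB.trans hBt.2.2⟩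
    have : {x | φ x = (e i).1} = ⋂ B ∈ t, {x | x ∈ B ↔ B ∈ (e i).1} := by
      ext x
      simp only [Set.mem_ofPred_eq, Set.mem_iInter, φ, Finset.ext_iff, Finset.mem_filter]
      refine ⟨fun h B hB => by rw [← h B]; simp [hB], fun h B => ⟨fun hB => (h B hB.1).1 hB.2,
        fun hB => ⟨hsub i hB, (h B (hsub i hB)).2 hB⟩⟩⟩
    change MeasurableSet {x | φ x = (e i).1}
    rw [this]
    refine Finset.measurableSet_biInter _ fun B hB => ?_
    by_cases h : B ∈ (e i).1
    · simpa [h] using (ht B hB).1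
    · have : {x | x ∈ B ↔ B ∈ (e i).1} = Bᶜ := by ext; simp [h]
      exact this ▸ (ht B hB).1.compl
  · refine Set.disjoint_left.2 fun x (hx : φ x = _) (hx' : φ x = _) => hij ?_
    exact e.injective (Subtype.ext (hx.symm.trans hx'))
  · refine ⟨Finset.univ.filter fun i => B ∈ (e i).1, ?_⟩
    ext x
    simp only [Set.mem_iUnion, Finset.mem_filter, Finset.mem_univ, true_and, exists_prop,
      Set.mem_ofPred_eq]
    refine ⟨fun hx => ?_, fun ⟨i, hi, hx⟩ => ?_⟩
    · have hBφ : B ∈ φ x := Finset.mem_filter.2 ⟨hB, hx⟩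
      have hmem : φ x ∈ t.powerset.erase ∅ := Finset.mem_erase.2
        ⟨Finset.ne_empty_of_mem hBφ, Finset.mem_powerset.2 (Finset.filter_subset _ _)⟩
      exact ⟨e.symm ⟨φ x, hmem⟩, by simpa using hBφ, by simp⟩
    · rw [← hx] at hi
      exact (Finset.mem_filter.1 hi).2

/-- A cylinder event is determined by the counts in a finite disjoint family, which can be chosen
such that a given set `B` is a union of its members. -/
lemma exists_counts_of_mem_cylinders {W B : Set Plane} (hB : B ∈ finiteAreaSets W)
    {T : Set (Measure Plane)} (hT : T ∈ cylinders W) :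
    ∃ (n : ℕ) (C : Fin n → Set Plane), (∀ i, C i ∈ finiteAreaSets W) ∧
      Pairwise (fun i j => Disjoint (C i) (C j)) ∧ (∃ J : Finset (Fin n), B = ⋃ j ∈ J, C j) ∧
      ∃ A : Set (Fin n → ℝ≥0∞), MeasurableSet A ∧ T = {μ | (fun i => μ (C i)) ∈ A} := by
  classical
  obtain ⟨t, htW, f, hf, rfl⟩ := hT
  obtain ⟨n, C, hC, hdisj, hJ⟩ := exists_disjoint_refinement (insert B t) (W := W) (by
    intro B' hB'
    rcases Finset.mem_insert.1 hB' with rfl | h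
    exacts [hB, htW h])
  refine ⟨n, C, hC, hdisj, hJ B (Finset.mem_insert_self _ _), ?_⟩
  choose! A hA hAf using hf
  choose! J hJ using hJ
  refine ⟨⋂ B' ∈ t, (fun k : Fin n → ℝ≥0∞ => ∑ j ∈ J B', k j) ⁻¹' A B',
    Finset.measurableSet_biInter _ fun B' hB' => (hA B' hB').preimage (by fun_prop), ?_⟩
  ext μ
  simp only [Set.mem_iInter, Set.mem_ofPred_eq, Set.mem_preimage]
  refine forall₂_congr fun B' hB' => ?_
  rw [← hAf B' hB', Set.mem_preimage]
  have : μ B' = ∑ j ∈ J B', μ (C j) := by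
    conv_lhs => rw [hJ B' (Finset.mem_insert_of_mem hB')]
    exact measure_biUnion_finset (fun i _ j _ hij => hdisj hij) fun i _ => (hC i).1
  rw [this]

/-! ### Uniqueness and translation invariance of the Poisson law -/

/-- Cylinder events form a generating π-system, and each depends only on the counts in a disjoint
family, whose joint law is prescribed. -/
lemma IsPoissonLaw.ext {Q Q' : Measure (Measure Plane)} [IsProbabilityMeasure Q]
    [IsProbabilityMeasure Q'] {lam : ℝ≥0} (h : IsPoissonLaw Q lam) (h' : IsPoissonLaw Q' lam) :
    Q = Q' := by
  refine ext_of_generate_finite _ generateFrom_cylinders_univ.symm (isPiSystem_cylinders _) ?_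
    (by simp)
  intro T hT
  obtain ⟨n, C, hC, hdisj, -, A, hA, rfl⟩ := exists_counts_of_mem_cylinders
    (B := ∅) ⟨by simp, by simp, by simp⟩ hT
  have hm : Measurable (fun (μ : Measure Plane) (i : Fin n) => μ (C i)) :=
    measurable_pi_lambda _ fun i => Measure.measurable_coe (hC i).1
  have := (h n C (fun i => (hC i).1) (fun i => (hC i).2.1) hdisj).trans
    (h' n C (fun i => (hC i).1) (fun i => (hC i).2.1) hdisj).symm
  have := congrArg (fun ν => ν A) this
  rwa [Measure.map_apply hm hA, Measure.map_apply hm hA] at this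

lemma measurable_translateMeasure (v : Plane) : Measurable (translateMeasure v) :=
  Measure.measurable_map _ (by fun_prop)

lemma translateMeasure_apply (v : Plane) (μ : Measure Plane) {B : Set Plane}
    (hB : MeasurableSet B) : translateMeasure v μ B = μ ((fun x => x + v) ⁻¹' B) :=
  Measure.map_apply (by fun_prop) hB

/-- The law of a homogeneous Poisson process is translation invariant. -/
lemma IsPoissonLaw.measurePreserving_translateMeasure {Q : Measure (Measure Plane)}
    [IsProbabilityMeasure Q] {lam : ℝ≥0} (h : IsPoissonLaw Q lam) (v : Plane) :
    MeasurePreserving (translateMeasure v) Q Q := by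
  have hv := measurable_translateMeasure v
  refine ⟨hv, ?_⟩
  have : IsProbabilityMeasure (Q.map (translateMeasure v)) :=
    Measure.isProbabilityMeasure_map hv.aemeasurable
  refine IsPoissonLaw.ext (lam := lam) (fun n C hC hfin hdisj => ?_) h
  have hm : Measurable (fun (μ : Measure Plane) (i : Fin n) => μ (C i)) :=
    measurable_pi_lambda _ fun i => Measure.measurable_coe (hC i)
  rw [Measure.map_map hm hv]
  have hvol (i) : volume ((fun x => x + v) ⁻¹' C i) = volume (C i) :=
    measure_preimage_add_right _ _ _
  have := h n (fun i => (fun x => x + v) ⁻¹' C i) (fun i => (hC i).preimage (by fun_prop))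
    (fun i => by rw [hvol]; exact hfin i) (fun i j hij => (hdisj hij).preimage _)
  simp only [hvol] at this
  rw [← this]
  congr 1
  funext μ i
  exact translateMeasure_apply v μ (hC i)

/-! ### Locally finite configurations as a kernel -/

/-- The locally finite measures on the plane. -/
def locallyFiniteMeasures : Set (Measure Plane) := {μ | ∀ n : ℕ, μ (Metric.ball 0 n) < ∞}

lemma measurableSet_locallyFiniteMeasures : MeasurableSet locallyFiniteMeasures := by
  have : locallyFiniteMeasures = ⋂ n : ℕ, {μ | μ (Metric.ball 0 n) < ∞} := by
    ext; simp [locallyFiniteMeasures]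
  rw [this]
  exact MeasurableSet.iInter fun n =>
    measurableSet_lt (Measure.measurable_coe measurableSet_ball) measurable_const

lemma measure_lt_top_of_isBounded {μ : Measure Plane} (hμ : μ ∈ locallyFiniteMeasures)
    {B : Set Plane} (hB : Bornology.IsBounded B) : μ B < ∞ := by
  obtain ⟨r, hr⟩ := hB.subset_ball 0
  obtain ⟨n, hn⟩ := exists_nat_ge r
  exact (measure_mono (hr.trans (Metric.ball_subset_ball hn))).trans_lt (hμ n)

/-- The identity kernel from measures to points. -/
noncomputable def selfKernel : Kernel (Measure Plane) Plane where
  toFun μ := μ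
  measurable' := measurable_id

open Classical in
/-- The kernel that maps a locally finite measure to itself, and any other measure to `0`. -/
noncomputable def localKernel : Kernel (Measure Plane) Plane :=
  Kernel.piecewise measurableSet_locallyFiniteMeasures selfKernel 0

open Classical in
lemma localKernel_of_mem {μ : Measure Plane} (hμ : μ ∈ locallyFiniteMeasures) :
    localKernel μ = μ := by
  rw [localKernel, Kernel.piecewise_apply, if_pos hμ]
  rfl

open Classical in
lemma localKernel_of_notMem {μ : Measure Plane} (hμ : μ ∉ locallyFiniteMeasures) :
    localKernel μ = 0 := by
  rw [localKernel, Kernel.piecewise_apply, if_neg hμ]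
  rfl

-- S-finiteness is what makes integration against the configuration jointly measurable and lets
-- Fubini apply; the value `0` off the locally finite measures makes it hold. The plane is cut into
-- annuli `A n`, and for each annulus the configurations are sorted by the integer part of their
-- mass there, so that each piece `K (n, k)` has mass at most k + 1.
open Classical in
instance : IsSFiniteKernel localKernel := by
  let A : ℕ → Set Plane := fun n => {x | ⌊‖x‖⌋₊ = n}
  have hA (n) : MeasurableSet (A n) :=
    (Nat.measurable_floor.comp measurable_norm) (measurableSet_singleton n)
  have hAb (n) : Bornology.IsBounded (A n) := by
    refine (Metric.isBounded_ball (x := (0 : Plane)) (r := n + 1)).subset fun x hx => ?_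
    have h : ⌊‖x‖⌋₊ = n := hx
    simpa [← h] using Nat.lt_floor_add_one ‖x‖
  let G : ℕ × ℕ → Set (Measure Plane) := fun p =>
    locallyFiniteMeasures ∩ {μ | ⌊(μ (A p.1)).toReal⌋₊ = p.2}
  have hG (p) : MeasurableSet (G p) := measurableSet_locallyFiniteMeasures.inter
    ((Nat.measurable_floor.comp (Measure.measurable_coe (hA p.1)).ennreal_toReal)
      (measurableSet_singleton p.2))
  let K : ℕ × ℕ → Kernel (Measure Plane) Plane := fun p =>
    Kernel.piecewise (hG p) (selfKernel.restrict (hA p.1)) 0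
  have hK (p) : IsFiniteKernel (K p) := by
    refine ⟨⟨p.2 + 1, by finiteness, fun μ => ?_⟩⟩
    simp only [K, Kernel.piecewise_apply]
    split_ifs with h
    · rw [Kernel.restrict_apply, Measure.restrict_apply_univ]
      have hlt : μ (A p.1) < ∞ := measure_lt_top_of_isBounded h.1 (hAb _)
      change μ (A p.1) ≤ _
      have h2 : ⌊(μ (A p.1)).toReal⌋₊ = p.2 := h.2
      have h3 := (Nat.lt_floor_add_one (μ (A p.1)).toReal).le
      rw [h2] at h3
      rw [← ENNReal.ofReal_toReal hlt.ne]
      refine (ENNReal.ofReal_le_ofReal h3).trans_eq ?_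
      rw [ENNReal.ofReal_add (by positivity) (by positivity)]
      simp
    · simp
  have : localKernel = Kernel.sum K := by
    ext μ s hs
    rw [Kernel.sum_apply' _ _ hs, ENNReal.tsum_prod' (f := fun p => K p μ s)]
    by_cases hμ : μ ∈ locallyFiniteMeasures
    · rw [localKernel_of_mem hμ]
      have h1 (n k : ℕ) : K (n, k) μ s
          = if k = ⌊(μ (A n)).toReal⌋₊ then μ (s ∩ A n) else 0 := by
        simp only [K, Kernel.piecewise_apply, G, Set.mem_inter_iff, hμ, true_and,
          Set.mem_ofPred_eq]
        by_cases h : ⌊(μ (A n)).toReal⌋₊ = k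
        · rw [if_pos h, if_pos h.symm, Kernel.restrict_apply, Measure.restrict_apply hs]
          rfl
        · rw [if_neg h, if_neg (Ne.symm h)]
          rfl
      simp only [h1, tsum_ite_eq]
      rw [← measure_iUnion]
      · congr 1
        ext x
        simp [A]
      · intro i j hij
        refine Set.disjoint_left.2 fun x hx hx' => hij ?_
        exact (show ⌊‖x‖⌋₊ = i from hx.2).symm.trans hx'.2
      · exact fun n => hs.inter (hA n)
    · rw [localKernel_of_notMem hμ]
      have h1 (p) : K p μ s = 0 := by
        simp only [K, Kernel.piecewise_apply]
        rw [if_neg (fun h => hμ h.1)]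
        rfl
      simp [h1]
  rw [this]
  exact Kernel.isSFiniteKernel_sum (hκs := fun p => inferInstance)

lemma add_dirac_mem_locallyFiniteMeasures {μ : Measure Plane} (hμ : μ ∈ locallyFiniteMeasures)
    (x : Plane) : μ + Measure.dirac x ∈ locallyFiniteMeasures := fun n => by
  rw [Measure.add_apply]
  exact ENNReal.add_lt_top.2 ⟨hμ n, measure_lt_top _ _⟩

lemma measurable_add_dirac :
    Measurable fun p : Measure Plane × Plane => p.1 + Measure.dirac p.2 := by
  refine Measure.measurable_of_measurable_coe _ fun s hs => ?_
  simp only [Measure.add_apply, Measure.dirac_apply' _ hs]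
  exact ((Measure.measurable_coe hs).comp measurable_fst).add
    ((measurable_one.indicator hs).comp measurable_snd)

/-! ### Void probabilities and the Mecke equation -/

lemma IsPoissonLaw.map_apply_eq {Q : Measure (Measure Plane)} {lam : ℝ≥0}
    (h : IsPoissonLaw Q lam) {B : Set Plane} (hB : MeasurableSet B) (hfin : volume B ≠ ∞) :
    Q.map (fun μ => μ B) = poissonENNReal (lam * (volume B).toNNReal) := by
  have h1 := h 1 (fun _ => B) (fun _ => hB) (fun _ => hfin) (fun i j hij => by omega)
  have h2 := congrArg (fun ν => ν.map (fun k : Fin 1 → ℝ≥0∞ => k 0)) h1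
  rw [Measure.map_map (by fun_prop)
    (measurable_pi_lambda _ fun i => Measure.measurable_coe hB)] at h2
  refine h2.trans ?_
  exact (measurePreserving_eval
    (fun _ : Fin 1 => poissonENNReal (lam * (volume B).toNNReal)) 0).map_eq

lemma IsPoissonLaw.ae_mem_locallyFiniteMeasures {Q : Measure (Measure Plane)} {lam : ℝ≥0}
    (h : IsPoissonLaw Q lam) : ∀ᵐ μ ∂Q, μ ∈ locallyFiniteMeasures := by
  refine ae_all_iff.2 fun n => ?_
  have hm : Measurable fun μ : Measure Plane => μ (Metric.ball 0 n) :=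
    Measure.measurable_coe measurableSet_ball
  refine ae_of_ae_map (p := fun k => k < ∞) hm.aemeasurable ?_
  rw [h.map_apply_eq measurableSet_ball measure_ball_lt_top.ne]
  exact ae_lt_top_poissonENNReal _

/-- The probability that a set contains no points. -/
lemma IsPoissonLaw.measure_eq_zero {Q : Measure (Measure Plane)} {lam : ℝ≥0}
    (h : IsPoissonLaw Q lam) {B : Set Plane} (hB : MeasurableSet B) (hfin : volume B ≠ ∞) :
    Q {μ | μ B = 0} = ENNReal.ofReal (Real.exp (-(lam * (volume B).toReal))) := by
  have hm : Measurable fun μ : Measure Plane => μ B := Measure.measurable_coe hB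
  have := h.map_apply_eq hB hfin
  have h2 := congrArg (fun ν => ν {0}) this
  rw [Measure.map_apply hm (measurableSet_singleton 0), poissonENNReal_singleton_zero] at h2
  exact h2

lemma isCountablySpanning_finiteAreaSets : IsCountablySpanning (finiteAreaSets Set.univ) :=
  ⟨fun n : ℕ => Metric.ball 0 n, fun _ => ⟨measurableSet_ball, measure_ball_lt_top.ne,
    Set.subset_univ _⟩, Metric.iUnion_ball_nat _⟩

lemma generateFrom_finiteAreaSets : MeasurableSpace.generateFrom (finiteAreaSets Set.univ)
    = (inferInstance : MeasurableSpace Plane) := by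
  refine le_antisymm (MeasurableSpace.generateFrom_le fun s hs => hs.1) fun s hs => ?_
  have : s = ⋃ n : ℕ, s ∩ Metric.ball 0 n := by
    rw [← Set.inter_iUnion, Metric.iUnion_ball_nat, Set.inter_univ]
  rw [this]
  refine MeasurableSet.iUnion (m := MeasurableSpace.generateFrom _) fun n =>
    MeasurableSpace.measurableSet_generateFrom ⟨hs.inter measurableSet_ball,
      ((measure_mono Set.inter_subset_right).trans_lt measure_ball_lt_top).ne, Set.subset_univ _⟩

lemma isPiSystem_finiteAreaSets : IsPiSystem (finiteAreaSets Set.univ) :=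
  fun _ hs _ ht _ => ⟨hs.1.inter ht.1,
    ((measure_mono Set.inter_subset_left).trans_lt hs.2.1.lt_top).ne, Set.subset_univ _⟩

/-- The Mecke equation for cylinder events. -/
lemma IsPoissonLaw.setLIntegral_cylinder {Q : Measure (Measure Plane)} {lam : ℝ≥0}
    (h : IsPoissonLaw Q lam) {B : Set Plane} (hB : B ∈ finiteAreaSets Set.univ)
    {T : Set (Measure Plane)} (hT : T ∈ cylinders Set.univ) :
    ∫⁻ μ in T, μ B ∂Q = lam * ∫⁻ x in B, Q {μ | μ + Measure.dirac x ∈ T} := by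
  classical
  obtain ⟨n, C, hC, hdisj, ⟨J, rfl⟩, A, hA, rfl⟩ := exists_counts_of_mem_cylinders hB hT
  have hm : Measurable (fun (μ : Measure Plane) (i : Fin n) => μ (C i)) :=
    measurable_pi_lambda _ fun i => Measure.measurable_coe (hC i).1
  have hlaw := h n C (fun i => (hC i).1) (fun i => (hC i).2.1) hdisj
  set π := Measure.pi (fun i => poissonENNReal (lam * (volume (C i)).toNNReal))
  have hAi : Measurable (A.indicator (1 : (Fin n → ℝ≥0∞) → ℝ≥0∞)) := measurable_one.indicator hA
  have hTm : MeasurableSet {μ : Measure Plane | (fun i => μ (C i)) ∈ A} := hm hA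
  have hL : ∫⁻ μ in {μ : Measure Plane | (fun i => μ (C i)) ∈ A}, μ (⋃ j ∈ J, C j) ∂Q
      = ∑ j ∈ J, ∫⁻ k, k j * A.indicator 1 k ∂π := by
    rw [← lintegral_finsetSum _ (fun j _ => by fun_prop), ← hlaw, lintegral_map (by fun_prop) hm,
      ← lintegral_indicator hTm]
    congr 1
    funext μ
    have hsum : μ (⋃ j ∈ J, C j) = ∑ j ∈ J, μ (C j) :=
      measure_biUnion_finset (fun i _ j _ hij => hdisj hij) fun i _ => (hC i).1
    by_cases hμ : (fun i => μ (C i)) ∈ A <;> simp [hμ, hsum]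
  have hR (j : Fin n) (x : Plane) (hx : x ∈ C j) :
      Q {μ | μ + Measure.dirac x ∈ {μ : Measure Plane | (fun i => μ (C i)) ∈ A}}
        = ∫⁻ k, A.indicator 1 (k + Pi.single j 1) ∂π := by
    have hm' : MeasurableSet {k : Fin n → ℝ≥0∞ | k + Pi.single j 1 ∈ A} :=
      hA.preimage (f := fun k : Fin n → ℝ≥0∞ => k + Pi.single j 1) (by fun_prop)
    have h1 : ∫⁻ k, A.indicator 1 (k + Pi.single j 1) ∂π = π {k | k + Pi.single j 1 ∈ A} := by
      rw [← lintegral_indicator_one hm']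
      rfl
    rw [h1, ← hlaw, Measure.map_apply hm hm']
    congr 1
    ext μ
    -- By disjointness `x` lies in `C j` only, so the extra point raises coordinate `j` by one: the
    -- shift appearing in `lintegral_mul_pi_poissonENNReal`.
    have : (fun i => (μ + Measure.dirac x) (C i)) = (fun i => μ (C i)) + Pi.single j 1 := by
      funext i
      rw [Measure.add_apply, Pi.add_apply, Measure.dirac_apply' _ (hC i).1]
      congr 1
      by_cases hij : i = j
      · subst hij; simp [hx]
      · have : x ∉ C i := fun hxi => Set.disjoint_left.1 (hdisj hij) hxi hx
        simp [hij, this]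
    simp only [Set.mem_ofPred_eq, Set.mem_preimage, this]
  rw [hL, lintegral_biUnion_finset (fun i _ j _ hij => hdisj hij) (fun i _ => (hC i).1),
    Finset.mul_sum]
  refine Finset.sum_congr rfl fun j _ => ?_
  rw [setLIntegral_congr_fun (hC j).1 (fun x hx => hR j x hx),
    lintegral_mul_pi_poissonENNReal _ _ hAi]
  simp only [lintegral_const, Measure.restrict_apply_univ]
  rw [ENNReal.coe_mul, ENNReal.coe_toNNReal (hC j).2.1]
  ring

/-- This is the Mecke equation as an identity of measures on configurations with a marked point.
Products of cylinder events with sets of finite area form a generating π-system on which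
`setLIntegral_cylinder` gives equality; the sets `univ ×ˢ ball 0 n` exhaust the space with finite
mass. -/
lemma IsPoissonLaw.compProd_localKernel {Q : Measure (Measure Plane)} [IsProbabilityMeasure Q]
    {lam : ℝ≥0} (h : IsPoissonLaw Q lam) :
    (lam : ℝ≥0∞) • (Q.prod volume).map (fun p => (p.1 + Measure.dirac p.2, p.2))
      = Q ⊗ₘ localKernel := by
  have hmap : Measurable fun p : Measure Plane × Plane => (p.1 + Measure.dirac p.2, p.2) :=
    measurable_add_dirac.prodMk measurable_snd
  have hval {T : Set (Measure Plane)} {B : Set Plane} (hT : MeasurableSet T)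
      (hB : MeasurableSet B) :
      ((lam : ℝ≥0∞) • (Q.prod volume).map (fun p => (p.1 + Measure.dirac p.2, p.2))) (T ×ˢ B)
        = lam * ∫⁻ x in B, Q {μ | μ + Measure.dirac x ∈ T} := by
    rw [Measure.smul_apply, Measure.map_apply hmap (hT.prod hB),
      Measure.prod_apply_symm (hmap (hT.prod hB)), smul_eq_mul, ← lintegral_indicator hB]
    congr 2
    funext x
    by_cases hx : x ∈ B <;> simp [hx, Set.preimage]
  refine Measure.ext_of_generateFrom_of_iUnion
    (Set.image2 (· ×ˢ ·) (cylinders Set.univ) (finiteAreaSets Set.univ))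
    (fun n : ℕ => Set.univ ×ˢ Metric.ball 0 n) ?_
    ((isPiSystem_cylinders _).prod isPiSystem_finiteAreaSets) ?_ ?_ ?_ ?_
  · rw [← generateFrom_prod_eq ⟨fun _ => Set.univ, fun _ => univ_mem_cylinders _,
        Set.iUnion_const _⟩
      isCountablySpanning_finiteAreaSets, generateFrom_cylinders_univ, generateFrom_finiteAreaSets]
  · rw [← Set.prod_iUnion, Metric.iUnion_ball_nat, Set.univ_prod_univ]
  · exact fun n => ⟨_, univ_mem_cylinders _, _, ⟨measurableSet_ball, measure_ball_lt_top.ne,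
      Set.subset_univ _⟩, rfl⟩
  · intro n
    rw [hval MeasurableSet.univ measurableSet_ball]
    simp only [Set.mem_univ, Set.ofPred_true, measure_univ, lintegral_const,
      Measure.restrict_apply_univ, one_mul]
    exact ENNReal.mul_ne_top ENNReal.coe_ne_top measure_ball_lt_top.ne
  · rintro _ ⟨T, hT, B, hB, rfl⟩
    have hTm : MeasurableSet T := by
      have := MeasurableSpace.measurableSet_generateFrom hT
      rwa [generateFrom_cylinders_univ] at this
    simp only
    rw [hval hTm hB.1, Measure.compProd_apply_prod hTm hB.1, ← h.setLIntegral_cylinder hB hT]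
    refine lintegral_congr_ae (ae_restrict_of_ae ?_)
    filter_upwards [h.ae_mem_locallyFiniteMeasures] with μ hμ
    rw [localKernel_of_mem hμ]

/-- The Mecke equation. -/
lemma IsPoissonLaw.mecke {Q : Measure (Measure Plane)} [IsProbabilityMeasure Q]
    {lam : ℝ≥0} (h : IsPoissonLaw Q lam) {f : Measure Plane → Plane → ℝ≥0∞}
    (hf : Measurable (Function.uncurry f)) :
    ∫⁻ μ, ∫⁻ x, f μ x ∂(localKernel μ) ∂Q
      = lam * ∫⁻ x, ∫⁻ μ, f (μ + Measure.dirac x) x ∂Q := by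
  have hmap : Measurable fun p : Measure Plane × Plane => (p.1 + Measure.dirac p.2, p.2) :=
    measurable_add_dirac.prodMk measurable_snd
  have := Measure.lintegral_compProd (μ := Q) (κ := localKernel) hf
  simp only [Function.uncurry_apply_pair] at this
  rw [← this, ← h.compProd_localKernel, lintegral_smul_measure, lintegral_map hf hmap,
    lintegral_prod_symm (fun p => Function.uncurry f (p.1 + Measure.dirac p.2, p.2))
      (hf.comp hmap).aemeasurable]
  rfl

/-! ### Independence over disjoint windows and ergodicity -/

/-- The restrictions of a Poisson process to disjoint windows are independent. -/
lemma IsPoissonLaw.indep_windowAlgebra {Q : Measure (Measure Plane)} [IsProbabilityMeasure Q]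
    {lam : ℝ≥0} (h : IsPoissonLaw Q lam) {W W' : Set Plane} (hW : Disjoint W W') :
    Indep (windowAlgebra W) (windowAlgebra W') Q := by
  refine IndepSets.indep (windowAlgebra_le _) (windowAlgebra_le _) (isPiSystem_cylinders W)
    (isPiSystem_cylinders W') (generateFrom_cylinders _).symm (generateFrom_cylinders _).symm ?_
  rw [IndepSets_iff]
  intro T T' hT hT'
  obtain ⟨n, C, hC, hdisj, -, A, hA, rfl⟩ := exists_counts_of_mem_cylinders
    (B := ∅) ⟨by simp, by simp, by simp⟩ hT
  obtain ⟨n', C', hC', hdisj', -, A', hA', rfl⟩ := exists_counts_of_mem_cylinders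
    (B := ∅) ⟨by simp, by simp, by simp⟩ hT'
  -- Since the windows are disjoint, the two families pool into one disjoint family with independent
  -- counts; independence of the events is that of two blocks of indices.
  let D : Fin n ⊕ Fin n' → Set Plane := Sum.elim C C'
  have hD (i) : MeasurableSet (D i) := by rcases i with i | i; exacts [(hC i).1, (hC' i).1]
  have hDfin (i) : volume (D i) ≠ ∞ := by rcases i with i | i; exacts [(hC i).2.1, (hC' i).2.1]
  have hDdisj : Pairwise (fun i j => Disjoint (D i) (D j)) := by
    rintro (i | i) (j | j) hij
    · exact hdisj fun h => hij (h ▸ rfl)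
    · exact hW.mono (hC i).2.2 (hC' j).2.2
    · exact (hW.mono (hC j).2.2 (hC' i).2.2).symm
    · exact hdisj' fun h => hij (h ▸ rfl)
  have hDm (i) : Measurable fun μ : Measure Plane => μ (D i) := Measure.measurable_coe (hD i)
  have hind : iIndepFun (fun i (μ : Measure Plane) => μ (D i)) Q := by
    rw [← iIndepFun_precomp_of_bijective (finSumFinEquiv (m := n) (n := n')).symm.bijective]
    refine (iIndepFun_iff_map_fun_eq_pi_map fun i => (hDm _).aemeasurable).2 ?_
    refine (h (n + n') (fun i => D (finSumFinEquiv.symm i)) (fun i => hD _) (fun i => hDfin _)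
      fun i j hij => hDdisj (finSumFinEquiv.symm.injective.ne hij)).trans ?_
    congr 1
    funext i
    exact (h.map_apply_eq (hD _) (hDfin _)).symm
  have := hind.indepFun_finset (Finset.univ.map Function.Embedding.inl)
    (Finset.univ.map Function.Embedding.inr) (Finset.disjoint_map_inl_map_inr _ _) hDm
  refine this.measure_inter_preimage_eq_mul
    ((fun k (i : Fin n) => k ⟨Sum.inl i, by simp⟩) ⁻¹' A)
    ((fun k (i : Fin n') => k ⟨Sum.inr i, by simp⟩) ⁻¹' A')
    (hA.preimage (by fun_prop)) (hA'.preimage (by fun_prop))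

lemma comap_translateMeasure_windowAlgebra (v : Plane) (W : Set Plane) {T : Set (Measure Plane)}
    (hT : MeasurableSet[windowAlgebra W] T) :
    MeasurableSet[windowAlgebra ((fun x => x + v) ⁻¹' W)] (translateMeasure v ⁻¹' T) := by
  have : Measurable[windowAlgebra ((fun x => x + v) ⁻¹' W), windowAlgebra W]
      (translateMeasure v) := by
    refine Measurable.of_comap_le ?_
    simp only [windowAlgebra, MeasurableSpace.comap_iSup, MeasurableSpace.comap_comp]
    refine iSup₂_le fun B hB => ?_
    refine le_iSup₂_of_le ((fun x => x + v) ⁻¹' B) ⟨hB.1.preimage (by fun_prop), ?_,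
      Set.preimage_mono hB.2.2⟩ (le_of_eq ?_)
    · rw [measure_preimage_add_right]
      exact hB.2.1
    · congr 1
      funext μ
      exact translateMeasure_apply v μ hB.1
  exact this hT

lemma isSetAlgebra_iUnion_windowAlgebra :
    IsSetAlgebra {T : Set (Measure Plane) |
      ∃ n : ℕ, MeasurableSet[windowAlgebra (Metric.ball 0 n)] T} where
  empty_mem := ⟨0, @MeasurableSet.empty _ (windowAlgebra _)⟩
  compl_mem := fun _ ⟨n, hn⟩ => ⟨n, hn.compl⟩
  union_mem := fun s t ⟨n, hn⟩ ⟨m, hm⟩ => ⟨max n m,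
    (windowAlgebra_mono (Metric.ball_subset_ball (by simp)) _ hn).union
      (windowAlgebra_mono (Metric.ball_subset_ball (by simp)) _ hm)⟩

/-- Every event can be approximated by an event that depends on a bounded window. -/
lemma exists_windowAlgebra_approx (Q : Measure (Measure Plane)) [IsProbabilityMeasure Q]
    {A : Set (Measure Plane)} (hA : MeasurableSet A) {ε : ℝ} (hε : 0 < ε) :
    ∃ (n : ℕ) (T : Set (Measure Plane)), MeasurableSet[windowAlgebra (Metric.ball 0 n)] T ∧
      Q.real (symmDiff A T) < ε := by
  have hd := Measure.MeasureDense.of_generateFrom_isSetAlgebra_finite (μ := Q)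
    isSetAlgebra_iUnion_windowAlgebra (by
      refine le_antisymm ?_ (MeasurableSpace.generateFrom_le fun s ⟨n, hn⟩ =>
        windowAlgebra_le _ _ hn)
      refine iSup_windowAlgebra_ball.symm.le.trans ?_
      exact iSup_le fun n s hs => MeasurableSpace.measurableSet_generateFrom ⟨n, hs⟩)
  obtain ⟨T, ⟨n, hn⟩, hT⟩ := hd.approx A hA (measure_ne_top _ _) ε hε
  exact ⟨n, T, hn, (ENNReal.lt_ofReal_iff_toReal_lt (measure_ne_top _ _)).1 hT⟩

/-- A homogeneous Poisson process is ergodic. -/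
lemma IsPoissonLaw.measure_eq_zero_or_one {Q : Measure (Measure Plane)} [IsProbabilityMeasure Q]
    {lam : ℝ≥0} (h : IsPoissonLaw Q lam) {A : Set (Measure Plane)} (hA : MeasurableSet A)
    (hinv : ∀ v : Plane, translateMeasure v ⁻¹' A =ᵐ[Q] A) : Q A = 0 ∨ Q A = 1 := by
  -- Of the 4ε, half is the cost of replacing `A` by `T ∩ T'`, half that of replacing Q(T)² by
  -- Q(A)².
  have key : ∀ ε > 0, |Q.real A - Q.real A ^ 2| ≤ 4 * ε := by
    intro ε hε
    obtain ⟨n, T, hTn, hT⟩ := exists_windowAlgebra_approx Q hA hε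
    have hTm := windowAlgebra_le _ _ hTn
    -- The length 2n + 1 exceeds the diameter of the window, which is therefore disjoint from its
    -- translate.
    let v : Plane := EuclideanSpace.single 0 (2 * n + 1 : ℝ)
    have hpres := h.measurePreserving_translateMeasure v
    have hT' := comap_translateMeasure_windowAlgebra v _ hTn
    set T' := translateMeasure v ⁻¹' T with hT'def
    have hT'm : MeasurableSet T' := hpres.measurable hTm
    have hdisj : Disjoint (Metric.ball (0 : Plane) n)
        ((fun x => x + v) ⁻¹' Metric.ball (0 : Plane) n) := by
      refine Set.disjoint_left.2 fun x hx hx' => ?_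
      simp only [Set.mem_preimage, mem_ball_zero_iff] at hx hx'
      have h1 : ‖v‖ = 2 * n + 1 := by
        simp only [v, PiLp.norm_single, Real.norm_eq_abs]
        exact abs_of_pos (by positivity)
      have h2 : ‖v‖ ≤ ‖x + v‖ + ‖x‖ := by simpa using norm_sub_le (x + v) x
      linarith
    have hind : Q.real (T ∩ T') = Q.real T * Q.real T' := by
      have := (Indep_iff _ _ _).1 (h.indep_windowAlgebra hdisj) T T' hTn hT'
      rw [measureReal_def, this, ENNReal.toReal_mul]
      rfl
    have hTT' : Q.real T' = Q.real T := by
      rw [measureReal_def, hpres.measure_preimage hTm.nullMeasurableSet]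
      rfl
    have hAT' : Q.real (symmDiff A T') = Q.real (symmDiff A T) := by
      have h1 : (symmDiff A T' : Set (Measure Plane)) =ᵐ[Q]
          translateMeasure v ⁻¹' symmDiff A T := by
        rw [Set.preimage_symmDiff]
        exact (hinv v).symm.symmDiff (ae_eq_refl _)
      rw [measureReal_congr h1, measureReal_def,
        hpres.measure_preimage (hA.symmDiff hTm).nullMeasurableSet]
      rfl
    have h1 : |Q.real A - Q.real (T ∩ T')| ≤ 2 * ε := by
      refine (abs_measureReal_sub_le_measureReal_symmDiff hA.nullMeasurableSet
        (hTm.inter hT'm).nullMeasurableSet).trans ?_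
      have hsub : symmDiff A (T ∩ T') ⊆ symmDiff A T ∪ symmDiff A T' := by
        intro μ
        simp only [Set.mem_symmDiff, Set.mem_union, Set.mem_inter_iff]
        tauto
      have := (measureReal_mono hsub).trans (measureReal_union_le (μ := Q) _ _)
      linarith
    have h2 := abs_measureReal_sub_le_measureReal_symmDiff (μ := Q) hA.nullMeasurableSet
      hTm.nullMeasurableSet
    have h3 : |Q.real T ^ 2 - Q.real A ^ 2| ≤ 2 * ε := by
      rw [sq_sub_sq, abs_mul, abs_sub_comm]
      have ha := measureReal_le_one (μ := Q) (s := A)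
      have hb := measureReal_le_one (μ := Q) (s := T)
      have ha0 := measureReal_nonneg (μ := Q) (s := A)
      have hb0 := measureReal_nonneg (μ := Q) (s := T)
      have : |Q.real T + Q.real A| ≤ 2 := by rw [abs_of_nonneg (by linarith)]; linarith
      exact mul_le_mul this (by linarith) (abs_nonneg _) (by norm_num)
    rw [hind, hTT', ← sq] at h1
    have := abs_sub_le (Q.real A) (Q.real T ^ 2) (Q.real A ^ 2)
    linarith
  have h0 : Q.real A - Q.real A ^ 2 = 0 := by
    by_contra hne
    have := key (|Q.real A - Q.real A ^ 2| / 8) (by positivity)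
    have : 0 < |Q.real A - Q.real A ^ 2| := by positivity
    linarith
  have h1 : Q.real A * (1 - Q.real A) = 0 := by linarith [h0]
  rcases mul_eq_zero.1 h1 with h2 | h2
  · left
    simpa using (measureReal_eq_zero_iff (μ := Q) (s := A)).1 h2
  · right
    rw [← ENNReal.toReal_eq_one_iff]
    change Q.real A = 1
    linarith

/-! ### Mecke equations for pairs and triples -/

lemma measurable_lintegral_localKernel {X : Type*} [MeasurableSpace X]
    {f : Measure Plane → X → Plane → ℝ≥0∞}
    (hf : Measurable fun p : (Measure Plane × X) × Plane => f p.1.1 p.1.2 p.2) :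
    Measurable fun p : Measure Plane × X => ∫⁻ y, f p.1 p.2 y ∂(localKernel p.1) :=
  hf.lintegral_kernel_prod_right' (κ := localKernel.comap Prod.fst measurable_fst)

lemma lintegral_localKernel_add_dirac {μ : Measure Plane} (hμ : μ ∈ locallyFiniteMeasures)
    (x : Plane) {f : Plane → ℝ≥0∞} (hf : Measurable f) :
    ∫⁻ y, f y ∂(localKernel (μ + Measure.dirac x)) = ∫⁻ y, f y ∂(localKernel μ) + f x := by
  rw [localKernel_of_mem (add_dirac_mem_locallyFiniteMeasures hμ x), localKernel_of_mem hμ,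
    lintegral_add_measure, lintegral_dirac' _ hf]

/-- The Mecke equation for pairs of points. -/
lemma IsPoissonLaw.mecke_pairs {Q : Measure (Measure Plane)} [IsProbabilityMeasure Q]
    {lam : ℝ≥0} (h : IsPoissonLaw Q lam) {f : Measure Plane → Plane → Plane → ℝ≥0∞}
    (hf : Measurable fun p : (Measure Plane × Plane) × Plane => f p.1.1 p.1.2 p.2)
    (hdiag : ∀ μ x, f μ x x = 0) :
    ∫⁻ μ, ∫⁻ x, ∫⁻ y, f μ x y ∂(localKernel μ) ∂(localKernel μ) ∂Q
      = lam ^ 2 * ∫⁻ x, ∫⁻ y, ∫⁻ μ, f (μ + Measure.dirac y + Measure.dirac x) x y ∂Q := by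
  -- Mecke is used in `x`, then in `y`. In between, the inner integral sees the added point `x`,
  -- whose contribution `hdiag` cancels.
  rw [h.mecke (f := fun μ x => ∫⁻ y, f μ x y ∂(localKernel μ))
      (measurable_lintegral_localKernel hf),
    pow_two, mul_assoc]
  congr 1
  rw [← lintegral_const_mul' _ _ ENNReal.coe_ne_top]
  congr 1
  funext x
  have hx : Measurable fun μ : Measure Plane => μ + Measure.dirac x :=
    measurable_add_dirac.comp (measurable_id.prodMk measurable_const)
  have h1 : Measurable fun p : Measure Plane × Plane => f (p.1 + Measure.dirac x) x p.2 :=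
    hf.comp (((hx.comp measurable_fst).prodMk measurable_const).prodMk measurable_snd)
  rw [← h.mecke (f := fun μ y => f (μ + Measure.dirac x) x y) h1]
  refine lintegral_congr_ae ?_
  filter_upwards [h.ae_mem_locallyFiniteMeasures] with μ hμ
  have h2 : Measurable (f (μ + Measure.dirac x) x) :=
    h1.comp (measurable_const.prodMk measurable_id)
  rw [lintegral_localKernel_add_dirac hμ x h2, hdiag, add_zero]

/-- Almost surely, no three distinct points of a Poisson process satisfy a relation that
almost every third point fails. -/
lemma IsPoissonLaw.ae_triples_eq_zero {Q : Measure (Measure Plane)} [IsProbabilityMeasure Q]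
    {lam : ℝ≥0} (h : IsPoissonLaw Q lam) {f : Plane → Plane → Plane → ℝ≥0∞}
    (hf : Measurable fun p : (Plane × Plane) × Plane => f p.1.1 p.1.2 p.2)
    (hxx : ∀ x w, f x x w = 0) (hfst : ∀ x y, f x y x = 0) (hsnd : ∀ x y, f x y y = 0)
    (hnull : ∀ x y, ∫⁻ w, f x y w = 0) :
    ∀ᵐ μ ∂Q, ∫⁻ x, ∫⁻ y, ∫⁻ w, f x y w ∂(localKernel μ) ∂(localKernel μ) ∂(localKernel μ) = 0 := by
  have hf3 : Measurable fun p : (Measure Plane × Plane × Plane) × Plane =>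
      f p.1.2.1 p.1.2.2 p.2 :=
    hf.comp (measurable_fst.snd.prodMk measurable_snd)
  have hf2' : Measurable fun p : Measure Plane × Plane × Plane =>
      ∫⁻ w, f p.2.1 p.2.2 w ∂(localKernel p.1) :=
    measurable_lintegral_localKernel (f := fun _ (q : Plane × Plane) w => f q.1 q.2 w) hf3
  have hf2 : Measurable fun p : (Measure Plane × Plane) × Plane =>
      ∫⁻ w, f p.1.2 p.2 w ∂(localKernel p.1.1) :=
    hf2'.comp (measurable_fst.fst.prodMk (measurable_fst.snd.prodMk measurable_snd))
  have hf1 : Measurable fun p : Measure Plane × Plane =>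
      ∫⁻ y, ∫⁻ w, f p.2 y w ∂(localKernel p.1) ∂(localKernel p.1) :=
    measurable_lintegral_localKernel (f := fun μ x y => ∫⁻ w, f x y w ∂(localKernel μ)) hf2
  have hf0 : Measurable fun μ : Measure Plane =>
      ∫⁻ x, ∫⁻ y, ∫⁻ w, f x y w ∂(localKernel μ) ∂(localKernel μ) ∂(localKernel μ) :=
    hf1.lintegral_kernel_prod_right' (κ := localKernel)
  refine (lintegral_eq_zero_iff hf0).1 ?_
  -- The integral over the third point is treated as a function of the pair. The two added points
  -- contribute nothing to it by `hfst` and `hsnd`, and a further Mecke step turns it into a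
  -- Lebesgue integral, zero by `hnull`.
  rw [h.mecke_pairs (f := fun μ x y => ∫⁻ w, f x y w ∂(localKernel μ)) hf2 (by simp [hxx])]
  refine mul_eq_zero_of_right _ ?_
  have : ∀ x y, ∫⁻ μ, ∫⁻ w, f x y w
      ∂(localKernel (μ + Measure.dirac y + Measure.dirac x)) ∂Q = 0 := by
    intro x y
    have hxy : Measurable (f x y) :=
      hf.comp ((measurable_const.prodMk measurable_const).prodMk measurable_id)
    have h1 : ∫⁻ μ, ∫⁻ w, f x y w ∂(localKernel (μ + Measure.dirac y + Measure.dirac x)) ∂Q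
        = ∫⁻ μ, ∫⁻ w, f x y w ∂(localKernel μ) ∂Q := by
      refine lintegral_congr_ae ?_
      filter_upwards [h.ae_mem_locallyFiniteMeasures] with μ hμ
      rw [lintegral_localKernel_add_dirac (add_dirac_mem_locallyFiniteMeasures hμ y) x hxy,
        lintegral_localKernel_add_dirac hμ y hxy, hfst, hsnd, add_zero, add_zero]
    rw [h1, h.mecke (f := fun _ w => f x y w) (hxy.comp measurable_snd)]
    simp [hnull]
  simp [this]

/-! ### Geometry of the angle vertex -/

variable (o : Orientation ℝ Plane (Fin 2)) (θ : ℝ)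

/-- The vector from `x` to the point that sees the segment from `x` to `x + u` at angle `θ` and is
equidistant from its end points. -/
noncomputable def angleOffset (u : Plane) : Plane :=
  (1 / 2 : ℝ) • u + (Real.cos (θ / 2) / (2 * Real.sin (θ / 2))) • o.rightAngleRotation u

/-- The point that is equidistant from `x` and `y` and sees them at angle `θ`. -/
noncomputable def angleVertex (x y : Plane) : Plane := x + angleOffset o θ (y - x)

/-- With R the rotation by θ, this says that `angleOffset` is a right inverse of 1 - R; it yields
existence of the vertex. Comparing coefficients of `u` and of its quarter turn leaves the
double-angle formulas for θ/2. -/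
lemma rotation_angleOffset (hθ : Real.sin (θ / 2) ≠ 0) (u : Plane) :
    o.rotation θ (angleOffset o θ u) = angleOffset o θ u - u := by
  obtain ⟨φ, rfl⟩ : ∃ φ, θ = 2 * φ := ⟨θ / 2, by ring⟩
  have e : 2 * φ / 2 = φ := by ring
  rw [Orientation.rotation_apply, Real.Angle.cos_coe, Real.Angle.sin_coe, angleOffset, map_add,
    map_smul, map_smul, Orientation.rightAngleRotation_rightAngleRotation, Real.cos_two_mul,
    Real.sin_two_mul]
  rw [e] at hθ ⊢
  have h := Real.sin_sq_add_cos_sq φ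
  match_scalars
  · field_simp
    ring
  · field_simp
    linear_combination 2 * Real.cos φ * h

/-- The left-inverse counterpart, which yields uniqueness of the vertex. -/
lemma angleOffset_rotation_sub (hθ : Real.sin (θ / 2) ≠ 0) (w : Plane) :
    angleOffset o θ (o.rotation θ w - w) = -w := by
  obtain ⟨φ, rfl⟩ : ∃ φ, θ = 2 * φ := ⟨θ / 2, by ring⟩
  have e : 2 * φ / 2 = φ := by ring
  rw [Orientation.rotation_apply, Real.Angle.cos_coe, Real.Angle.sin_coe, angleOffset, map_sub,
    map_add,
    map_smul, map_smul, Orientation.rightAngleRotation_rightAngleRotation, Real.cos_two_mul,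
    Real.sin_two_mul]
  rw [e] at hθ ⊢
  have h := Real.sin_sq_add_cos_sq φ
  match_scalars
  · field_simp
    ring
  · field_simp
    linear_combination 2 * Real.cos φ * h

/-- Pythagoras with orthogonal legs ‖u‖/2 and ‖u‖ |cot (θ/2)| / 2. -/
lemma norm_angleOffset (hθ : 0 < Real.sin (θ / 2)) (u : Plane) :
    ‖angleOffset o θ u‖ = ‖u‖ / (2 * Real.sin (θ / 2)) := by
  have h1 : ‖angleOffset o θ u‖ ^ 2 = (‖u‖ / (2 * Real.sin (θ / 2))) ^ 2 := by
    rw [angleOffset, norm_add_sq_real, norm_smul, norm_smul, inner_smul_left, inner_smul_right,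
      Orientation.inner_rightAngleRotation_right, LinearIsometryEquiv.norm_map, mul_pow, mul_pow,
      Real.norm_eq_abs, Real.norm_eq_abs, sq_abs, sq_abs]
    simp only [Orientation.areaForm_apply_self]
    have h := Real.sin_sq_add_cos_sq (θ / 2)
    field_simp
    simp
    linear_combination ‖u‖ ^ 2 * h
  exact (sq_eq_sq₀ (norm_nonneg _) (by positivity)).1 h1

@[fun_prop]
lemma continuous_angleOffset : Continuous (angleOffset o θ) := by
  have := o.rightAngleRotation.continuous
  unfold angleOffset
  fun_prop

lemma continuous_angleVertex : Continuous fun p : Plane × Plane => angleVertex o θ p.1 p.2 := by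
  unfold angleVertex
  fun_prop

lemma angleVertex_add_right (x y v : Plane) :
    angleVertex o θ (x + v) (y + v) = angleVertex o θ x y + v := by
  simp only [angleVertex, add_sub_add_right_eq_sub]
  abel

lemma rotation_sub_angleVertex (hθ : Real.sin (θ / 2) ≠ 0) (x y : Plane) :
    o.rotation θ (x - angleVertex o θ x y) = y - angleVertex o θ x y := by
  have : x - angleVertex o θ x y = - angleOffset o θ (y - x) := by simp [angleVertex]
  rw [this, map_neg, rotation_angleOffset o θ hθ, angleVertex]
  abel

lemma eq_angleVertex_of_rotation (hθ : Real.sin (θ / 2) ≠ 0) {x y z : Plane}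
    (h : o.rotation θ (x - z) = y - z) : z = angleVertex o θ x y := by
  have := angleOffset_rotation_sub o θ hθ (x - z)
  rw [h, sub_sub_sub_cancel_right] at this
  rw [angleVertex, this]
  abel

lemma dist_angleVertex_eq (hθ : Real.sin (θ / 2) ≠ 0) (x y : Plane) :
    dist y (angleVertex o θ x y) = dist x (angleVertex o θ x y) := by
  rw [dist_eq_norm, dist_eq_norm, ← rotation_sub_angleVertex o θ hθ, LinearIsometryEquiv.norm_map]

lemma dist_angleVertex (hθ : 0 < Real.sin (θ / 2)) (x y : Plane) :
    dist x (angleVertex o θ x y) = ‖y - x‖ / (2 * Real.sin (θ / 2)) := by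
  rw [← norm_angleOffset o θ hθ, dist_eq_norm, ← norm_neg]
  simp [angleVertex]

lemma eq_angleVertex_iff (hθ : Real.sin (θ / 2) ≠ 0) {x y z : Plane} (hxy : x ≠ y) :
    z = angleVertex o θ x y ↔
      dist z x = dist z y ∧ o.oangle (x - z) (y - z) = (θ : Real.Angle) := by
  constructor
  · rintro rfl
    have h := rotation_sub_angleVertex o θ hθ x y
    refine ⟨by rw [dist_comm, ← dist_angleVertex_eq o θ hθ, dist_comm], ?_⟩
    rw [← h]
    refine o.oangle_rotation_self_right (fun h0 => hxy ?_) _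
    rw [h0, map_zero] at h
    exact (sub_eq_zero.1 h0).trans (sub_eq_zero.1 h.symm).symm
  · rintro ⟨hd, ho⟩
    have hx : x - z ≠ 0 := fun h0 => hxy <| by
      rw [sub_eq_zero.1 h0, dist_self] at hd
      rw [sub_eq_zero.1 h0]
      exact dist_eq_zero.1 hd.symm
    have hn : ‖y - z‖ = ‖x - z‖ := by
      rw [← dist_eq_norm, ← dist_eq_norm, dist_comm, ← hd, dist_comm]
    have hy : y - z ≠ 0 := by
      rw [← norm_ne_zero_iff, hn]
      exact norm_ne_zero_iff.2 hx
    have := (o.oangle_eq_iff_eq_norm_div_norm_smul_rotation_of_ne_zero hx hy θ).1 ho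
    rw [hn, div_self (norm_ne_zero_iff.2 hx), one_smul] at this
    exact eq_angleVertex_of_rotation o θ hθ this.symm

lemma Precedes.ne {x y : Plane} (h : Precedes x y) : x ≠ y := by
  rintro rfl
  rcases h with h | h
  exacts [lt_irrefl _ h, lt_irrefl _ h.2]

lemma Precedes.not_precedes {x y : Plane} (h : Precedes x y) : ¬ Precedes y x := by
  rcases h with h | ⟨h, h'⟩ <;> rintro (k | ⟨k, k'⟩) <;> linarith

lemma precedes_or_precedes {x y : Plane} (h : x ≠ y) : Precedes x y ∨ Precedes y x := by
  rcases lt_trichotomy (x 0) (y 0) with h0 | h0 | h0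
  · exact Or.inl (Or.inl h0)
  · rcases lt_trichotomy (x 1) (y 1) with h1 | h1 | h1
    · exact Or.inl (Or.inr ⟨h0, h1⟩)
    · refine absurd ?_ h
      ext i
      fin_cases i
      exacts [h0, h1]
    · exact Or.inr (Or.inr ⟨h0.symm, h1⟩)
  · exact Or.inr (Or.inl h0)

/-! ### Empty pairs and Delaunay neighbours -/

/-- The ordered pairs of points of `S` whose circle around the angle vertex encloses no point. -/
def emptyPairs (S : Set Plane) : Set (Plane × Plane) :=
  {p | p.1 ∈ S ∧ p.2 ∈ S ∧ Precedes p.1 p.2 ∧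
    ∀ w ∈ S, dist p.1 (angleVertex o θ p.1 p.2) ≤ dist w (angleVertex o θ p.1 p.2)}

/-- No third point lies on the circle through two points around their angle vertex. -/
def NoThirdCocircular (S : Set Plane) : Prop :=
  ∀ x ∈ S, ∀ y ∈ S, ∀ w ∈ S, x ≠ y → w ≠ x → w ≠ y →
    dist w (angleVertex o θ x y) ≠ dist x (angleVertex o θ x y)

variable {o θ}

lemma anglePoints_subset_image (hθ : Real.sin (θ / 2) ≠ 0) (S : Set Plane) :
    anglePoints o θ S ⊆ (fun p => angleVertex o θ p.1 p.2) '' emptyPairs o θ S := by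
  rintro z ⟨x, y, ⟨hx, hy, hxy, -⟩, hprec, ⟨hzx, hzy⟩, hang⟩
  have hz := (eq_angleVertex_iff o θ hθ hxy).2 ⟨le_antisymm (hzx y hy) (hzy x hx), hang⟩
  refine ⟨(x, y), ⟨hx, hy, hprec, fun w hw => ?_⟩, hz.symm⟩
  rw [← hz, dist_comm, dist_comm w]
  exact hzx w hw

lemma angleVertex_injOn_emptyPairs (hθ : Real.sin (θ / 2) ≠ 0) {S : Set Plane}
    (hS : NoThirdCocircular o θ S) :
    Set.InjOn (fun p => angleVertex o θ p.1 p.2) (emptyPairs o θ S) := by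
  rintro ⟨x, y⟩ ⟨hx, hy, hxy, hmin⟩ ⟨x', y'⟩ ⟨hx', hy', hxy', hmin'⟩ hz
  simp only at hx hy hxy hmin hx' hy' hxy' hmin' hz
  rw [← hz] at hmin'
  have hd : dist x' (angleVertex o θ x y) = dist x (angleVertex o θ x y) :=
    le_antisymm (hmin' x hx) (hmin x' hx')
  have hd' : dist y' (angleVertex o θ x y) = dist x (angleVertex o θ x y) := by
    rw [← hd, hz, dist_angleVertex_eq o θ hθ]
  have h1 : x' = x ∨ x' = y := by
    by_contra! h
    exact hS x hx y hy x' hx' hxy.ne h.1 h.2 hd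
  have h2 : y' = x ∨ y' = y := by
    by_contra! h
    exact hS x hx y hy y' hy' hxy.ne h.1 h.2 hd'
  -- Both points of the second pair belong to the first; the order rules out the swapped and the
  -- degenerate cases.
  rcases h1 with rfl | rfl <;> rcases h2 with rfl | rfl
  · exact absurd rfl hxy'.ne
  · rfl
  · exact absurd hxy' hxy.not_precedes
  · exact absurd rfl hxy'.ne

/-- Only finitely many points lie within r + 1 of `z`, so strict inequalities improve to a uniform
gap. -/
lemma exists_isolated_radius {S : Set Plane}
    (hfin : ∀ B : Set Plane, Bornology.IsBounded B → (S ∩ B).Finite) (z : Plane) (r : ℝ)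
    (F : Set Plane) (h : ∀ w ∈ S, w ∉ F → r < dist w z) :
    ∃ δ > 0, ∀ w ∈ S, w ∉ F → r + δ ≤ dist w z := by
  have hT : ∀ T : Set Plane, T.Finite → (∀ w ∈ T, r < dist w z) →
      ∃ δ > 0, ∀ w ∈ T, r + δ ≤ dist w z := by
    intro T hT
    induction T, hT using Set.Finite.induction_on with
    | empty => exact fun _ => ⟨1, one_pos, by simp⟩
    | @insert a s _ _ ih =>
      intro h2
      obtain ⟨δ, hδ, hw⟩ := ih fun w hw => h2 w (Set.mem_insert_of_mem _ hw)
      have := h2 a (Set.mem_insert _ _)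
      refine ⟨min δ (dist a z - r), lt_min hδ (by linarith), ?_⟩
      rintro w (rfl | hws)
      · linarith [min_le_right δ (dist w z - r)]
      · linarith [min_le_left δ (dist a z - r), hw w hws]
  obtain ⟨δ, hδ, hw⟩ := hT _ ((hfin _ Metric.isBounded_ball).sdiff (t := F))
    fun w (hw : w ∈ (S ∩ Metric.ball z (r + 1)) \ F) => h w hw.1.1 hw.2
  refine ⟨min δ 1, lt_min hδ one_pos, fun w hwS hwF => ?_⟩
  by_cases hb : w ∈ Metric.ball z (r + 1)
  · linarith [min_le_left δ 1, hw w ⟨⟨hwS, hb⟩, hwF⟩]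
  · rw [Metric.mem_ball, not_lt] at hb
    linarith [min_le_right δ 1]

/-- The vertex itself is one common point of the cells. By general position all other nuclei are
farther away by a margin δ, so a small move along the bisector gives a second common point. -/
lemma isDelaunayPair_of_mem_emptyPairs (hθ : Real.sin (θ / 2) ≠ 0) {S : Set Plane}
    (hfin : ∀ B : Set Plane, Bornology.IsBounded B → (S ∩ B).Finite)
    (hS : NoThirdCocircular o θ S) {x y : Plane} (h : (x, y) ∈ emptyPairs o θ S) :
    IsDelaunayPair S x y := by
  obtain ⟨hx, hy, hprec, hmin⟩ := h
  simp only at hx hy hprec hmin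
  refine ⟨hx, hy, hprec.ne, ?_⟩
  set z := angleVertex o θ x y
  set r := dist x z
  have hyz : dist y z = r := dist_angleVertex_eq o θ hθ x y
  obtain ⟨δ, hδ, hw⟩ := exists_isolated_radius hfin z r {x, y} fun w hw hwxy => by
    simp only [Set.mem_insert_iff, Set.mem_singleton_iff, not_or] at hwxy
    exact lt_of_le_of_ne (hmin w hw) (hS x hx y hy w hw hprec.ne hwxy.1 hwxy.2).symm
  let J := o.rightAngleRotation (y - x)
  have hJ : J ≠ 0 := by
    simpa [J, sub_eq_zero] using hprec.ne.symm
  have hJn : 0 < ‖J‖ := norm_pos_iff.2 hJ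
  -- A move of length δ/2 raises the distance to `x` and `y` by at most δ/2 and lowers every other
  -- one by at most δ/2, so the margin δ just suffices.
  let v : Plane := (δ / (2 * ‖J‖)) • J
  have hv : v ≠ 0 := smul_ne_zero (by positivity) hJ
  have hvn : ‖v‖ = δ / 2 := by
    rw [norm_smul, Real.norm_of_nonneg (by positivity)]
    field_simp
  have hJinner : inner ℝ (y - x) v = 0 := by
    simp only [v, J]
    rw [inner_smul_right, Orientation.inner_rightAngleRotation_right,
      Orientation.areaForm_apply_self, neg_zero, mul_zero]
  have hbis : dist (z + v) x = dist (z + v) y := by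
    have h1 : ‖z - x‖ = ‖z - y‖ := by
      rw [← dist_eq_norm, ← dist_eq_norm, dist_comm, dist_comm z y, hyz]
    have e1 : z + v - x = (z - x) + v := by abel
    have e2 : z + v - y = (z - y) + v := by abel
    have h2 : inner ℝ (z - x) v = inner ℝ (z - y) v := by
      have : z - x = (z - y) + (y - x) := by abel
      rw [this, inner_add_left, hJinner, add_zero]
    rw [dist_eq_norm, dist_eq_norm, ← sq_eq_sq₀ (norm_nonneg _) (norm_nonneg _), e1, e2,
      norm_add_sq_real, norm_add_sq_real, h1, h2]
  have hclose : dist (z + v) x ≤ r + δ / 2 := by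
    refine (dist_triangle _ z _).trans ?_
    rw [dist_comm z x, dist_eq_norm, add_sub_cancel_left, hvn]
    linarith
  have hall : ∀ w ∈ S, dist (z + v) x ≤ dist (z + v) w := by
    intro w hwS
    by_cases h : w ∈ ({x, y} : Set Plane)
    · rcases h with rfl | rfl
      exacts [le_rfl, hbis.le]
    · have h1 := hw w hwS h
      have h2 := dist_triangle w (z + v) z
      rw [dist_eq_norm (z + v) z, add_sub_cancel_left, hvn, dist_comm w (z + v)] at h2
      linarith
  have hall0 : ∀ w ∈ S, dist z x ≤ dist z w := fun w hw => by
    rw [dist_comm, dist_comm z w]; exact hmin w hw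
  refine ⟨z, ⟨hall0, fun w hw => ?_⟩, z + v, ⟨hall, fun w hw => ?_⟩, by simpa using hv⟩
  · rw [dist_comm z y, hyz, show r = dist z x from dist_comm _ _]
    exact hall0 w hw
  · rw [← hbis]
    exact hall w hw

/-- For configurations in general position, the angle points are the vertices of empty pairs. -/
lemma anglePoints_eq_image (hθ : Real.sin (θ / 2) ≠ 0) {S : Set Plane}
    (hfin : ∀ B : Set Plane, Bornology.IsBounded B → (S ∩ B).Finite)
    (hS : NoThirdCocircular o θ S) :
    anglePoints o θ S = (fun p => angleVertex o θ p.1 p.2) '' emptyPairs o θ S := by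
  refine (anglePoints_subset_image hθ S).antisymm ?_
  rintro _ ⟨⟨x, y⟩, h, rfl⟩
  obtain ⟨hx, hy, hprec, hmin⟩ := id h
  simp only at hx hy hprec hmin ⊢
  have hd := (eq_angleVertex_iff o θ hθ hprec.ne).1 rfl
  have hzx : angleVertex o θ x y ∈ voronoiCell S x := fun w hw => by
    rw [dist_comm, dist_comm _ w]; exact hmin w hw
  refine ⟨x, y, isDelaunayPair_of_mem_emptyPairs hθ hfin hS h, hprec, ⟨hzx, fun w hw => ?_⟩, hd.2⟩
  rw [← hd.1]
  exact hzx w hw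

/-! ### The angle points as a measurable equivariant functional -/

variable (o θ)

lemma measurableSet_precedes : MeasurableSet {p : Plane × Plane | Precedes p.1 p.2} := by
  have h (i : Fin 2) : Measurable fun p : Plane × Plane => p.1 i := by fun_prop
  have h' (i : Fin 2) : Measurable fun p : Plane × Plane => p.2 i := by fun_prop
  exact (measurableSet_lt (h 0) (h' 0)).union
    ((measurableSet_eq_fun (h 0) (h' 0)).inter (measurableSet_lt (h 1) (h' 1)))

/-- The ordered pairs of points with angle vertex in `B` whose open disc around the angle vertex
contains no point of a configuration. -/
def emptyPairSet (B : Set Plane) : Set ((Measure Plane × Plane) × Plane) :=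
  {q | Precedes q.1.2 q.2 ∧ angleVertex o θ q.1.2 q.2 ∈ B ∧
    localKernel q.1.1 (Metric.ball (angleVertex o θ q.1.2 q.2)
      (dist q.1.2 (angleVertex o θ q.1.2 q.2))) = 0}

lemma measurableSet_emptyPairSet {B : Set Plane} (hB : MeasurableSet B) :
    MeasurableSet (emptyPairSet o θ B) := by
  have hpair : Measurable fun q : (Measure Plane × Plane) × Plane => (q.1.2, q.2) := by fun_prop
  have hv : Measurable fun q : (Measure Plane × Plane) × Plane => angleVertex o θ q.1.2 q.2 :=
    (continuous_angleVertex o θ).measurable.comp hpair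
  -- The disc moves with the pair, so its count is the kernel mass of a section of a jointly
  -- measurable set.
  have hvoid : Measurable fun q : (Measure Plane × Plane) × Plane =>
      localKernel q.1.1 (Metric.ball (angleVertex o θ q.1.2 q.2)
        (dist q.1.2 (angleVertex o θ q.1.2 q.2))) := by
    have ht : MeasurableSet {r : ((Measure Plane × Plane) × Plane) × Plane |
        dist r.2 (angleVertex o θ r.1.1.2 r.1.2)
          < dist r.1.1.2 (angleVertex o θ r.1.1.2 r.1.2)} := by
      have hv' : Measurable fun r : ((Measure Plane × Plane) × Plane) × Plane =>
          angleVertex o θ r.1.1.2 r.1.2 := hv.comp measurable_fst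
      exact measurableSet_lt (measurable_snd.dist hv') ((by fun_prop : Measurable fun
        r : ((Measure Plane × Plane) × Plane) × Plane => r.1.1.2).dist hv')
    exact Kernel.measurable_kernel_prodMk_left
      (κ := localKernel.comap (fun q : (Measure Plane × Plane) × Plane => q.1.1) (by fun_prop)) ht
  exact (hpair measurableSet_precedes).inter ((hv hB).inter (hvoid (measurableSet_singleton 0)))

/-- The counting measure of the angle points, as a functional of the counting measure of the
configuration. -/
noncomputable def angleMeasure (μ : Measure Plane) : Measure Plane :=
  (((localKernel μ).prod (localKernel μ)).restrict
    {p | ((μ, p.1), p.2) ∈ emptyPairSet o θ Set.univ}).map fun p => angleVertex o θ p.1 p.2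

lemma angleMeasure_apply (μ : Measure Plane) {B : Set Plane} (hB : MeasurableSet B) :
    angleMeasure o θ μ B = ∫⁻ x, ∫⁻ y, (emptyPairSet o θ B).indicator 1 ((μ, x), y)
      ∂(localKernel μ) ∂(localKernel μ) := by
  have hm : Measurable fun p : Plane × Plane => ((μ, p.1), p.2) := by fun_prop
  have hB' : MeasurableSet ((fun p : Plane × Plane => angleVertex o θ p.1 p.2) ⁻¹' B) :=
    (continuous_angleVertex o θ).measurable hB
  have hset : (fun p : Plane × Plane => angleVertex o θ p.1 p.2) ⁻¹' B ∩
      {p | ((μ, p.1), p.2) ∈ emptyPairSet o θ Set.univ}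
      = {p | ((μ, p.1), p.2) ∈ emptyPairSet o θ B} := by
    ext p
    simp only [emptyPairSet, Set.mem_inter_iff, Set.mem_preimage, Set.mem_ofPred_eq, Set.mem_univ,
      true_and]
    tauto
  rw [angleMeasure, Measure.map_apply (continuous_angleVertex o θ).measurable hB,
    Measure.restrict_apply hB', hset]
  refine (Measure.prod_apply (hm (measurableSet_emptyPairSet o θ hB))).trans ?_
  refine lintegral_congr fun x => ?_
  rw [← lintegral_indicator_one]
  · rfl
  · exact measurable_prodMk_left (hm (measurableSet_emptyPairSet o θ hB))

lemma measurable_angleMeasure : Measurable (angleMeasure o θ) := by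
  refine Measure.measurable_of_measurable_coe _ fun B hB => ?_
  simp only [angleMeasure_apply o θ _ hB]
  have h1 : Measurable ((emptyPairSet o θ B).indicator
      (1 : (Measure Plane × Plane) × Plane → ℝ≥0∞)) :=
    measurable_one.indicator (measurableSet_emptyPairSet o θ hB)
  exact (measurable_lintegral_localKernel
    (f := fun μ x y => (emptyPairSet o θ B).indicator 1 ((μ, x), y)) h1
    ).lintegral_kernel_prod_right' (κ := localKernel)

lemma translateMeasure_mem_locallyFiniteMeasures {μ : Measure Plane}
    (hμ : μ ∈ locallyFiniteMeasures) (v : Plane) :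
    translateMeasure v μ ∈ locallyFiniteMeasures := fun n => by
  rw [translateMeasure_apply v μ measurableSet_ball, Metric.preimage_add_right_ball]
  exact measure_lt_top_of_isBounded hμ Metric.isBounded_ball

lemma precedes_add_right_iff (x y v : Plane) : Precedes (x + v) (y + v) ↔ Precedes x y := by
  simp [Precedes]

/-- The construction of the angle points commutes with translations. -/
lemma angleMeasure_translateMeasure {μ : Measure Plane} (hμ : μ ∈ locallyFiniteMeasures)
    (v : Plane) :
    angleMeasure o θ (translateMeasure v μ) = translateMeasure v (angleMeasure o θ μ) := by
  ext B hB
  rw [translateMeasure_apply _ _ hB, angleMeasure_apply _ _ _ hB,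
    angleMeasure_apply _ _ _ (hB.preimage (by fun_prop)),
    localKernel_of_mem (translateMeasure_mem_locallyFiniteMeasures hμ v), localKernel_of_mem hμ,
    translateMeasure, (measurableEmbedding_addRight v).lintegral_map]
  refine lintegral_congr fun x => ?_
  rw [(measurableEmbedding_addRight v).lintegral_map]
  refine lintegral_congr fun y => ?_
  refine Set.indicator_eq_indicator ?_ rfl
  simp only [emptyPairSet, Set.mem_ofPred_eq, Set.mem_preimage, precedes_add_right_iff,
    angleVertex_add_right, dist_add_right]
  have h1 := translateMeasure_mem_locallyFiniteMeasures hμ v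
  rw [translateMeasure] at h1
  rw [localKernel_of_mem h1, localKernel_of_mem hμ,
    Measure.map_apply (by fun_prop) measurableSet_ball, Metric.preimage_add_right_ball,
    add_sub_cancel_right]

lemma countable_of_locallyFinite {S : Set Plane}
    (hfin : ∀ B : Set Plane, Bornology.IsBounded B → (S ∩ B).Finite) : S.Countable := by
  have : S = ⋃ n : ℕ, S ∩ Metric.ball 0 n := by
    rw [← Set.inter_iUnion, Metric.iUnion_ball_nat, Set.inter_univ]
  rw [this]
  exact Set.countable_iUnion fun n => (hfin _ Metric.isBounded_ball).countable

lemma pointMeasure_apply (S : Set Plane) {B : Set Plane} (hB : MeasurableSet B) :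
    pointMeasure S B = (S ∩ B).encard := by
  rw [pointMeasure, Measure.restrict_apply hB, Set.inter_comm]
  by_cases h : (S ∩ B).Finite
  · rw [Measure.count_apply h.measurableSet]
  · rw [Measure.count_apply_infinite h, Set.Infinite.encard_eq h]
    rfl

lemma pointMeasure_mem_locallyFiniteMeasures {S : Set Plane}
    (hfin : ∀ B : Set Plane, Bornology.IsBounded B → (S ∩ B).Finite) :
    pointMeasure S ∈ locallyFiniteMeasures := fun n => by
  rw [pointMeasure_apply _ measurableSet_ball]
  have := hfin _ (Metric.isBounded_ball (x := (0 : Plane)) (r := n))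
  simpa using this

lemma lintegral_pointMeasure {S : Set Plane} (hS : S.Countable) (f : Plane → ℝ≥0∞) :
    ∫⁻ x, f x ∂(pointMeasure S) = ∑' x, S.indicator f x := by
  rw [pointMeasure, lintegral_countable _ hS, ← tsum_subtype]
  simp

/-- The left side counts empty pairs with vertex in a set, as a double sum over `S`; the right side
counts the vertices. Injectivity of the vertex map on empty pairs equates the two. -/
lemma angleMeasure_pointMeasure (hθ : Real.sin (θ / 2) ≠ 0) {S : Set Plane}
    (hfin : ∀ B : Set Plane, Bornology.IsBounded B → (S ∩ B).Finite)
    (hS : NoThirdCocircular o θ S) :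
    angleMeasure o θ (pointMeasure S) = pointMeasure (anglePoints o θ S) := by
  have hc := countable_of_locallyFinite hfin
  have hloc := pointMeasure_mem_locallyFiniteMeasures hfin
  ext B hB
  rw [angleMeasure_apply _ _ _ hB, localKernel_of_mem hloc, pointMeasure_apply _ hB,
    anglePoints_eq_image hθ hfin hS, ← Set.image_inter_preimage,
    ((angleVertex_injOn_emptyPairs hθ hS).mono Set.inter_subset_left).encard_image,
    lintegral_pointMeasure hc, ← ENNReal.tsum_set_one, tsum_subtype _ fun _ => (1 : ℝ≥0∞),
    ENNReal.tsum_prod']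
  refine tsum_congr fun x => ?_
  have hvoid (y : Plane) : ((pointMeasure S, x), y) ∈ emptyPairSet o θ B ↔
      Precedes x y ∧ angleVertex o θ x y ∈ B ∧
        ∀ w ∈ S, dist x (angleVertex o θ x y) ≤ dist w (angleVertex o θ x y) := by
    simp only [emptyPairSet, Set.mem_ofPred_eq]
    rw [localKernel_of_mem hloc, pointMeasure_apply _ measurableSet_ball]
    simp [Set.eq_empty_iff_forall_notMem]
  by_cases hx : x ∈ S
  · rw [Set.indicator_of_mem hx, lintegral_pointMeasure hc]
    refine tsum_congr fun y => ?_
    by_cases hy : y ∈ S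
    · rw [Set.indicator_of_mem hy]
      refine Set.indicator_eq_indicator ((hvoid y).trans ?_) rfl
      simp only [emptyPairs, Set.mem_inter_iff, Set.mem_ofPred_eq, Set.mem_preimage, hx, hy,
        true_and]
      tauto
    · rw [Set.indicator_of_notMem hy, Set.indicator_of_notMem fun h => hy h.1.2.1]
  · rw [Set.indicator_of_notMem hx]
    refine (ENNReal.tsum_eq_zero.2 fun y => Set.indicator_of_notMem (fun h => hx h.1.1) _).symm

/-! ### Almost sure general position -/

namespace IsPoissonProcess

/-- Almost surely, a Poisson process has no third point on the circle through two of its points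
around their angle vertex. -/
lemma ae_noThirdCocircular {Ω : Type*} [MeasurableSpace Ω] {P : Measure Ω}
    [IsProbabilityMeasure P] {Φ : Ω → Set Plane} {lam : ℝ≥0} (h : IsPoissonProcess P Φ lam) :
    ∀ᵐ ω ∂P, NoThirdCocircular o θ (Φ ω) := by
  have hQ : IsProbabilityMeasure (law P Φ) :=
    Measure.isProbabilityMeasure_map h.aemeasurable_pointMeasure
  -- The three inequations make the indicator vanish on all diagonals, as `ae_triples_eq_zero`
  -- requires.
  let E : Set ((Plane × Plane) × Plane) := {p | p.1.1 ≠ p.1.2 ∧ p.2 ≠ p.1.1 ∧ p.2 ≠ p.1.2 ∧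
    dist p.2 (angleVertex o θ p.1.1 p.1.2) = dist p.1.1 (angleVertex o θ p.1.1 p.1.2)}
  have hv : Measurable fun p : (Plane × Plane) × Plane => angleVertex o θ p.1.1 p.1.2 :=
    (continuous_angleVertex o θ).measurable.comp measurable_fst
  have h1 : Measurable fun p : (Plane × Plane) × Plane => p.1.1 := by fun_prop
  have h2 : Measurable fun p : (Plane × Plane) × Plane => p.1.2 := by fun_prop
  have h3 : Measurable fun p : (Plane × Plane) × Plane => p.2 := by fun_prop
  have hE : MeasurableSet E := (measurableSet_eq_fun h1 h2).compl.inter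
    ((measurableSet_eq_fun h3 h1).compl.inter ((measurableSet_eq_fun h3 h2).compl.inter
      (measurableSet_eq_fun (h3.dist hv) (h1.dist hv))))
  have hnull (x y : Plane) : ∫⁻ w, E.indicator 1 ((x, y), w) = 0 := by
    have hs : MeasurableSet {w | ((x, y), w) ∈ E} := measurable_prodMk_left hE
    have : ∫⁻ w, E.indicator 1 ((x, y), w) = volume {w | ((x, y), w) ∈ E} := by
      rw [← lintegral_indicator_one hs]
      rfl
    rw [this]
    refine measure_mono_null (t := Metric.sphere (angleVertex o θ x y)
      (dist x (angleVertex o θ x y))) (fun w hw => hw.2.2.2) (Measure.addHaar_sphere _ _ _)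
  have hae := h.isPoissonLaw.ae_triples_eq_zero (f := fun x y w => E.indicator 1 ((x, y), w))
    (measurable_one.indicator hE) (fun x w => Set.indicator_of_notMem (fun h => h.1 rfl) _)
    (fun x y => Set.indicator_of_notMem (fun h => h.2.1 rfl) _)
    (fun x y => Set.indicator_of_notMem (fun h => h.2.2.1 rfl) _) hnull
  filter_upwards [ae_of_ae_map h.aemeasurable_pointMeasure hae, h.ae_locallyFinite]
    with ω hω hfin x hx y hy w hw hxy hwx hwy hd
  have hc := countable_of_locallyFinite hfin
  rw [localKernel_of_mem (pointMeasure_mem_locallyFiniteMeasures hfin), lintegral_pointMeasure hc,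
    ENNReal.tsum_eq_zero] at hω
  have hωx := hω x
  rw [Set.indicator_of_mem hx, lintegral_pointMeasure hc, ENNReal.tsum_eq_zero] at hωx
  have hωy := hωx y
  rw [Set.indicator_of_mem hy, lintegral_pointMeasure hc, ENNReal.tsum_eq_zero] at hωy
  have hωw := hωy w
  rw [Set.indicator_of_mem hw, Set.indicator_of_mem (show ((x, y), w) ∈ E from
    ⟨hxy, hwx, hwy, hd⟩)] at hωw
  exact one_ne_zero hωw

lemma angleMeasure_ae_eq {Ω : Type*} [MeasurableSpace Ω] {P : Measure Ω}
    [IsProbabilityMeasure P] {Φ : Ω → Set Plane} {lam : ℝ≥0} (h : IsPoissonProcess P Φ lam)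
    (hθ : Real.sin (θ / 2) ≠ 0) :
    (fun ω => angleMeasure o θ (pointMeasure (Φ ω)))
      =ᵐ[P] fun ω => pointMeasure (anglePoints o θ (Φ ω)) := by
  filter_upwards [h.ae_noThirdCocircular o θ, h.ae_locallyFinite] with ω hω hfin
  exact angleMeasure_pointMeasure o θ hθ hfin hω

end IsPoissonProcess

/-! ### Computation of the intensity -/

lemma measurableSet_precedes_zero : MeasurableSet {u : Plane | Precedes 0 u} :=
  measurable_prodMk_left measurableSet_precedes

/-- The integral of an even function over a half-plane. -/
lemma two_mul_setLIntegral_precedes_zero {φ : Plane → ℝ≥0∞} (hφ : ∀ u, φ (-u) = φ u) :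
    2 * ∫⁻ u in {u | Precedes 0 u}, φ u = ∫⁻ u, φ u := by
  have hH := measurableSet_precedes_zero
  rw [← lintegral_add_compl (μ := volume) φ hH, two_mul]
  congr 1
  rw [← lintegral_indicator hH, ← lintegral_indicator hH.compl,
    ← lintegral_neg_eq_self (μ := volume) ({u : Plane | Precedes 0 u}ᶜ.indicator φ)]
  refine lintegral_congr_ae ?_
  -- Reflection exchanges the half-plane with its complement except at the origin, which is null.
  have h0 : ∀ᵐ u : Plane, u ≠ 0 := by simp [ae_iff]
  filter_upwards [h0] with u hu
  have h1 : Precedes 0 (-u) ↔ Precedes u 0 := by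
    simpa using (precedes_add_right_iff 0 (-u) u).symm
  have h2 : Precedes 0 u ↔ ¬ Precedes u 0 :=
    ⟨fun h => h.not_precedes, fun h => (precedes_or_precedes hu).resolve_left h⟩
  have h3 : -u ∈ {u : Plane | Precedes 0 u}ᶜ ↔ Precedes 0 u := by
    rw [Set.mem_compl_iff, Set.mem_ofPred_eq, h1, h2]
  by_cases hu0 : Precedes 0 u
  · rw [Set.indicator_of_mem (h3.2 hu0), Set.indicator_of_mem (by exact hu0), hφ]
  · rw [Set.indicator_of_notMem fun h => hu0 (h3.1 h), Set.indicator_of_notMem (by exact hu0)]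

lemma setLIntegral_gaussian_precedes_zero {b : ℝ} (hb : 0 < b) :
    ∫⁻ u in {u : Plane | Precedes 0 u}, ENNReal.ofReal (Real.exp (-b * ‖u‖ ^ 2))
      = ENNReal.ofReal (Real.pi / (2 * b)) := by
  have hfull : ∫⁻ u : Plane, ENNReal.ofReal (Real.exp (-b * ‖u‖ ^ 2))
      = ENNReal.ofReal (Real.pi / b) := by
    have h1 := GaussianFourier.integral_rexp_neg_mul_sq_norm (V := Plane) hb
    rw [finrank_euclideanSpace_fin] at h1
    norm_num at h1
    have h2 : Integrable fun u : Plane => Real.exp (-b * ‖u‖ ^ 2) := by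
      -- A non-integrable function has Bochner integral 0, so the nonzero value π/b forces
      -- integrability.
      refine Integrable.of_integral_ne_zero ?_
      norm_num
      rw [h1]
      positivity
    rw [← ofReal_integral_eq_lintegral_ofReal h2 (ae_of_all _ fun u => (Real.exp_pos _).le)]
    norm_num
    rw [h1]
  have h2 := two_mul_setLIntegral_precedes_zero
    (φ := fun u => ENNReal.ofReal (Real.exp (-b * ‖u‖ ^ 2))) (by simp)
  rw [hfull] at h2
  have h3 : ENNReal.ofReal (Real.pi / b) = 2 * ENNReal.ofReal (Real.pi / (2 * b)) := by
    rw [← ENNReal.ofReal_ofNat 2, ← ENNReal.ofReal_mul (by norm_num)]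
    congr 1
    field_simp
  rw [h3] at h2
  exact (ENNReal.mul_right_inj (by norm_num) (by norm_num)).1 h2

/-- The probability that an ordered pair of additional points is an empty pair with angle vertex
in `B`. -/
lemma IsPoissonLaw.lintegral_indicator_emptyPairSet {Q : Measure (Measure Plane)}
    [IsProbabilityMeasure Q] {lam : ℝ≥0} (h : IsPoissonLaw Q lam) (hθ : 0 < Real.sin (θ / 2))
    (B : Set Plane) (x y : Plane) :
    ∫⁻ μ, (emptyPairSet o θ B).indicator 1 ((μ + Measure.dirac y + Measure.dirac x, x), y) ∂Q
      = {p : Plane × Plane | Precedes p.1 p.2 ∧ angleVertex o θ p.1 p.2 ∈ B}.indicator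
        (fun p => ENNReal.ofReal (Real.exp
          (-(lam * Real.pi / (2 * Real.sin (θ / 2)) ^ 2) * ‖p.2 - p.1‖ ^ 2))) (x, y) := by
  by_cases hxy : Precedes x y ∧ angleVertex o θ x y ∈ B
  · rw [Set.indicator_of_mem (by exact hxy)]
    set D := Metric.ball (angleVertex o θ x y) (dist x (angleVertex o θ x y)) with hD
    -- The added points lie on the boundary of the open disc, so they do not affect its emptiness.
    have hx : x ∉ D := by simp [D]
    have hy : y ∉ D := by simp [D, dist_angleVertex_eq o θ hθ.ne']
    have h1 : ∫⁻ μ, (emptyPairSet o θ B).indicator 1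
          ((μ + Measure.dirac y + Measure.dirac x, x), y) ∂Q
        = ∫⁻ μ, {μ : Measure Plane | μ D = 0}.indicator 1 μ ∂Q := by
      refine lintegral_congr_ae ?_
      filter_upwards [h.ae_mem_locallyFiniteMeasures] with μ hμ
      refine Set.indicator_eq_indicator ?_ rfl
      have hμ' := add_dirac_mem_locallyFiniteMeasures (add_dirac_mem_locallyFiniteMeasures hμ y) x
      simp only [emptyPairSet, Set.mem_ofPred_eq, hxy, true_and, localKernel_of_mem hμ', ← hD]
      simp [hx, hy]
    have hDm : MeasurableSet {μ : Measure Plane | μ D = 0} :=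
      (Measure.measurable_coe measurableSet_ball) (measurableSet_singleton 0)
    rw [h1, lintegral_indicator_one hDm,
      h.measure_eq_zero measurableSet_ball measure_ball_lt_top.ne,
      EuclideanSpace.volume_ball_fin_two, dist_angleVertex o θ hθ]
    congr 2
    rw [ENNReal.toReal_mul, ENNReal.toReal_pow, ENNReal.toReal_ofReal (by positivity),
      ENNReal.toReal_ofReal Real.pi_pos.le]
    ring
  · rw [Set.indicator_of_notMem (by exact hxy)]
    refine (lintegral_congr fun μ => ?_).trans lintegral_zero
    exact Set.indicator_of_notMem (fun h => hxy ⟨h.1, h.2.1⟩) _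

/-- The substitution `(x, y) = (x, x + u)` in an integral over ordered pairs. -/
lemma lintegral_pairs_angleVertex {B : Set Plane} (hB : MeasurableSet B) {φ : Plane → ℝ≥0∞}
    (hφ : Measurable φ) :
    ∫⁻ x, ∫⁻ y, {p : Plane × Plane | Precedes p.1 p.2 ∧ angleVertex o θ p.1 p.2 ∈ B}.indicator
      (fun p => φ (p.2 - p.1)) (x, y)
      = (∫⁻ u in {u | Precedes 0 u}, φ u) * volume B := by
  have hH := measurableSet_precedes_zero
  have h1 (x : Plane) : ∫⁻ y, {p : Plane × Plane | Precedes p.1 p.2 ∧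
        angleVertex o θ p.1 p.2 ∈ B}.indicator (fun p => φ (p.2 - p.1)) (x, y)
      = ∫⁻ u, {u | Precedes 0 u}.indicator φ u * B.indicator 1 (x + angleOffset o θ u) := by
    rw [← lintegral_add_right_eq_self _ x]
    refine lintegral_congr fun u => ?_
    have h2 : Precedes x (u + x) ↔ Precedes 0 u := by
      simpa using precedes_add_right_iff 0 u x
    have h3 : (x, u + x) ∈ {p : Plane × Plane | Precedes p.1 p.2 ∧ angleVertex o θ p.1 p.2 ∈ B} ↔
        Precedes 0 u ∧ x + angleOffset o θ u ∈ B := by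
      simp only [Set.mem_ofPred_eq, h2, angleVertex, add_sub_cancel_right]
    by_cases ha : Precedes 0 u
    · by_cases hb : x + angleOffset o θ u ∈ B
      · rw [Set.indicator_of_mem (h3.2 ⟨ha, hb⟩), Set.indicator_of_mem (by exact ha),
          Set.indicator_of_mem hb]
        simp
      · rw [Set.indicator_of_notMem fun h => hb (h3.1 h).2, Set.indicator_of_notMem hb, mul_zero]
    · rw [Set.indicator_of_notMem fun h => ha (h3.1 h).1, Set.indicator_of_notMem (by exact ha),
        zero_mul]
  have hm : Measurable fun p : Plane × Plane =>
      {u | Precedes 0 u}.indicator φ p.2 *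
        B.indicator (1 : Plane → ℝ≥0∞) (p.1 + angleOffset o θ p.2) :=
    ((hφ.indicator hH).comp measurable_snd).mul ((measurable_one.indicator hB).comp
      (measurable_fst.add ((continuous_angleOffset o θ).measurable.comp measurable_snd)))
  simp only [h1]
  -- With `u` fixed, the vertex is a translate of `x`, so integrating over `x` first gives the area
  -- of `B`.
  rw [lintegral_lintegral_swap hm.aemeasurable, ← lintegral_indicator hH,
    ← lintegral_mul_const _ (hφ.indicator hH)]
  refine lintegral_congr fun u => ?_
  have hu : Measurable fun x => B.indicator (1 : Plane → ℝ≥0∞) (x + angleOffset o θ u) :=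
    (measurable_one.indicator hB).comp (measurable_add_const _)
  rw [lintegral_const_mul _ hu,
    lintegral_add_right_eq_self (fun x => B.indicator (1 : Plane → ℝ≥0∞) x),
    lintegral_indicator_one hB]

lemma IsPoissonLaw.lintegral_angleMeasure {Q : Measure (Measure Plane)} [IsProbabilityMeasure Q]
    {lam : ℝ≥0} (h : IsPoissonLaw Q lam) (hlam : 0 < lam) (hθ : 0 < Real.sin (θ / 2))
    {B : Set Plane} (hB : MeasurableSet B) :
    ∫⁻ μ, angleMeasure o θ μ B ∂Q
      = ENNReal.ofReal (2 * lam * Real.sin (θ / 2) ^ 2) * volume B := by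
  have hlam' : (0 : ℝ) < lam := hlam
  simp only [angleMeasure_apply o θ _ hB]
  rw [h.mecke_pairs (f := fun μ x y => (emptyPairSet o θ B).indicator 1 ((μ, x), y))
    (measurable_one.indicator (measurableSet_emptyPairSet o θ hB))
    (fun μ x => Set.indicator_of_notMem (fun h => h.1.ne rfl) _)]
  simp only [h.lintegral_indicator_emptyPairSet o θ hθ]
  -- Here b = λπ / (4 sin²(θ/2)), hence π / (2b) = 2 sin²(θ/2) / λ, and the factor λ² leaves 2λ
  -- sin²(θ/2).
  rw [lintegral_pairs_angleVertex o θ hB (φ := fun u => ENNReal.ofReal (Real.exp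
      (-(lam * Real.pi / (2 * Real.sin (θ / 2)) ^ 2) * ‖u‖ ^ 2))) (by fun_prop),
    setLIntegral_gaussian_precedes_zero (by positivity), ← mul_assoc]
  congr 1
  rw [← ENNReal.ofReal_coe_nnreal, ← ENNReal.ofReal_pow (by positivity),
    ← ENNReal.ofReal_mul (by positivity)]
  congr 1
  field_simp

/-! ### Transfer to the process of angle points -/

namespace IsPoissonProcess

variable {Ω : Type*} [MeasurableSpace Ω] {P : Measure Ω} [IsProbabilityMeasure P]
  {Φ : Ω → Set Plane} {lam : ℝ≥0}

lemma isProbabilityMeasure_law (h : IsPoissonProcess P Φ lam) :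
    IsProbabilityMeasure (law P Φ) :=
  Measure.isProbabilityMeasure_map h.aemeasurable_pointMeasure

lemma aemeasurable_anglePoints (h : IsPoissonProcess P Φ lam)
    (hθ : Real.sin (θ / 2) ≠ 0) :
    AEMeasurable (fun ω => pointMeasure (anglePoints o θ (Φ ω))) P :=
  ((measurable_angleMeasure o θ).comp_aemeasurable h.aemeasurable_pointMeasure).congr
    (h.angleMeasure_ae_eq o θ hθ)

lemma law_anglePoints (h : IsPoissonProcess P Φ lam)
    (hθ : Real.sin (θ / 2) ≠ 0) :
    law P (fun ω => anglePoints o θ (Φ ω)) = (law P Φ).map (angleMeasure o θ) := by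
  rw [law, law, AEMeasurable.map_map_of_aemeasurable (measurable_angleMeasure o θ).aemeasurable
    h.aemeasurable_pointMeasure]
  exact Measure.map_congr (h.angleMeasure_ae_eq o θ hθ).symm

lemma hasIntensity_anglePoints (h : IsPoissonProcess P Φ lam) (hlam : 0 < lam)
    (hθ : 0 < Real.sin (θ / 2)) :
    HasIntensity P (fun ω => anglePoints o θ (Φ ω))
      (ENNReal.ofReal (2 * lam * Real.sin (θ / 2) ^ 2)) := by
  intro B hB
  have := h.isProbabilityMeasure_law
  have hm : Measurable fun μ => angleMeasure o θ μ B :=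
    (Measure.measurable_coe hB).comp (measurable_angleMeasure o θ)
  rw [← h.isPoissonLaw.lintegral_angleMeasure o θ hlam hθ hB, law,
    lintegral_map' hm.aemeasurable h.aemeasurable_pointMeasure]
  refine lintegral_congr_ae ?_
  filter_upwards [h.angleMeasure_ae_eq o θ hθ.ne'] with ω hω
  rw [← hω]

lemma isPointProcess_anglePoints (h : IsPoissonProcess P Φ lam) (hlam : 0 < lam)
    (hθ : 0 < Real.sin (θ / 2)) :
    IsPointProcess P (fun ω => anglePoints o θ (Φ ω)) := by
  have hae := h.aemeasurable_anglePoints o θ hθ.ne'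
  refine ⟨?_, hae⟩
  -- A count with finite mean is almost surely finite; countably many balls catch all bounded sets.
  have hlt : ∀ᵐ ω ∂P, ∀ n : ℕ, pointMeasure (anglePoints o θ (Φ ω)) (Metric.ball 0 n) < ∞ := by
    refine ae_all_iff.2 fun n => ae_lt_top' ?_ ?_
    · exact (Measure.measurable_coe measurableSet_ball).comp_aemeasurable hae
    · rw [h.hasIntensity_anglePoints o θ hlam hθ _ measurableSet_ball]
      exact ENNReal.mul_ne_top ENNReal.ofReal_ne_top measure_ball_lt_top.ne
  filter_upwards [hlt] with ω hω B hB
  obtain ⟨r, hr⟩ := hB.subset_ball 0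
  obtain ⟨n, hn⟩ := exists_nat_ge r
  have h1 := hω n
  rw [pointMeasure_apply _ measurableSet_ball] at h1
  have h2 : (anglePoints o θ (Φ ω) ∩ Metric.ball 0 n).Finite := by simpa using h1
  exact h2.subset (Set.inter_subset_inter_right _ (hr.trans (Metric.ball_subset_ball hn)))

lemma angleMeasure_translateMeasure_ae_eq (h : IsPoissonProcess P Φ lam)
    (v : Plane) : angleMeasure o θ ∘ translateMeasure v
      =ᵐ[law P Φ] translateMeasure v ∘ angleMeasure o θ := by
  filter_upwards [h.isPoissonLaw.ae_mem_locallyFiniteMeasures] with μ hμ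
  exact angleMeasure_translateMeasure o θ hμ v

lemma isStationary_anglePoints (h : IsPoissonProcess P Φ lam)
    (hθ : Real.sin (θ / 2) ≠ 0) : IsStationary P (fun ω => anglePoints o θ (Φ ω)) := by
  intro v
  have := h.isProbabilityMeasure_law
  have hF := measurable_angleMeasure o θ
  have hv := measurable_translateMeasure v
  refine ⟨hv, ?_⟩
  rw [h.law_anglePoints o θ hθ, Measure.map_map hv hF,
    ← Measure.map_congr (h.angleMeasure_translateMeasure_ae_eq o θ v), ← Measure.map_map hF hv,
    (h.isPoissonLaw.measurePreserving_translateMeasure v).map_eq]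

lemma isErgodic_anglePoints (h : IsPoissonProcess P Φ lam)
    (hθ : Real.sin (θ / 2) ≠ 0) : IsErgodic P (fun ω => anglePoints o θ (Φ ω)) := by
  intro A hA hinv
  have := h.isProbabilityMeasure_law
  have hF := measurable_angleMeasure o θ
  rw [h.law_anglePoints o θ hθ] at hinv ⊢
  rw [Measure.map_apply hF hA]
  -- By equivariance, the preimage of an almost invariant event is almost invariant for the Poisson
  -- law.
  refine h.isPoissonLaw.measure_eq_zero_or_one (hF hA) fun v => ?_
  have h1 : angleMeasure o θ ⁻¹' (translateMeasure v ⁻¹' A) =ᵐ[law P Φ] angleMeasure o θ ⁻¹' A :=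
    (hF.quasiMeasurePreserving _).preimage_ae_eq (hinv v)
  refine Filter.EventuallyEq.trans ?_ h1
  filter_upwards [h.angleMeasure_translateMeasure_ae_eq o θ v] with μ hμ
  exact congrArg (· ∈ A) hμ

end IsPoissonProcess

end PoissonVoronoi

theorem mainTheorem2 {Ω : Type*} [MeasurableSpace Ω] (P : Measure Ω) [IsProbabilityMeasure P]
    (lam : ℝ≥0) (hlam : 0 < lam) (Φ : Ω → Set PoissonVoronoi.Plane)
    (hΦ : PoissonVoronoi.IsPoissonProcess P Φ lam)
    (o : Orientation ℝ PoissonVoronoi.Plane (Fin 2))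
    (θ : ℝ) (hθ : θ ∈ Set.Ioo 0 (2 * Real.pi)) :
    PoissonVoronoi.IsPointProcess P (fun ω => PoissonVoronoi.anglePoints o θ (Φ ω)) ∧
    PoissonVoronoi.IsStationary P (fun ω => PoissonVoronoi.anglePoints o θ (Φ ω)) ∧
    PoissonVoronoi.IsErgodic P (fun ω => PoissonVoronoi.anglePoints o θ (Φ ω)) ∧
    PoissonVoronoi.HasIntensity P (fun ω => PoissonVoronoi.anglePoints o θ (Φ ω))
      (ENNReal.ofReal (2 * lam * Real.sin (θ / 2) ^ 2)) := by
  have hs : 0 < Real.sin (θ / 2) :=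
    Real.sin_pos_of_pos_of_lt_pi (by linarith [hθ.1]) (by linarith [hθ.2])
  exact ⟨hΦ.isPointProcess_anglePoints o θ hlam hs, hΦ.isStationary_anglePoints o θ hs.ne',
    hΦ.isErgodic_anglePoints o θ hs.ne', hΦ.hasIntensity_anglePoints o θ hlam hs⟩
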